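/- **Theorem 6.1.** Let $h\ge 12$ and let $V=E\oplus F$ be a complex vector space with basis $e_1,\dots,e_h$ (of $E$), $f_1,\dots,f_h$ (of $F$), with the quadratic form $Q\bigl(\sum x_ie_i+\sum y_if_i\bigr)=\sum x_iy_i$. Put $f=f_1\cdots f_h\in Cl(V,Q)$ and identify the space of spinors $Cl(E,Q|_E)=\Lambda E$ with the left ideal $Cl(V,Q)f$ by $s\mapsto sf$. For a maximal totally isotropic subspace $W\subset V$ let $f_W$ be the Clifford product of the vectors of a basis of $W$; a representative spinor of $W$ is a nonzero $s\in Cl(E,Q|_E)$ with $sf\in f_W\,Cl(V,Q)$. Such spinors, for all $W$, are the pure spinors. Let $S_h$ be the component, containing the class of $e_1\cdots e_h$, of the projective variety of pure spinors, that is, the variety of classes of the pure spinors that have the parity of $h$. If $\widehat S_h$ denotes the affine cone over $S_h$, the affine tangent space to $S_h$ at the point represented by $s$ is the linear space of all vectors annihilated by the differentials at $s$ of all polynomial functions vanishing on $\widehat S_h$. For a skew-symmetric $h\times h$ matrix $U$, write $[\,I_h\mid U\,]$ for the point of $S_h$ given by the representative spinors of the subspace spanned by the rows of that matrix, i.e.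 by $e_i+\sum_j u_{ij}f_j$, $1\le i\le h$. Let $$P_k^h=\left[\,I_h\;\middle|\;\begin{pmatrix}A_k&0\\0&0\end{pmatrix}\right],\qquad k=0,1,2,$$ where $A_0=0$, $A_1=J_6$ and $A_2=K_6$ are the skew-symmetric $12\times12$ matrices such that $J_6$ has six diagonal blocks $\begin{pmatrix}0&1\\-1&0\end{pmatrix}$ and $K_6$ has the six diagonal blocks $\begin{pmatrix}0&t\\-t&0\end{pmatrix}$, $t=2,3,\dots,7$ in this order. Then $P_0^h,P_1^h,P_2^h$ are points of $S_h$, and the affine tangent spaces to $S_h$ at $P_0^h$, $P_1^h$, $P_2^h$ are linearly independent, i.e. their sum is direct. -/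

import Mathlib

open scoped BigOperators

noncomputable section

namespace SpinorVariety

/-! ### The quadratic space `V = E ⊕ F`, of dimension `2 h` -/

/-- The complex vector space `V = E ⊕ F` of dimension `2 h`, in the coordinates of a basis
`e_1, …, e_h, f_1, …, f_h`, where `e_i` is the basis vector of index `Sum.inl i` and `f_i` the one
of index `Sum.inr i`. -/
abbrev V (h : ℕ) : Type := Fin h ⊕ Fin h → ℂ

/-- The maximal totally isotropic subspace `E = ⟨e_1, …, e_h⟩`, as a vector space of its own. -/
abbrev E (h : ℕ) : Type := Fin h → ℂ

/-- The non degenerate quadratic form `Q (∑ x_i e_i + ∑ y_i f_i) = ∑ x_i y_i`. The bilinear form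
`B` with `B (v, v) = Q v` satisfies `B (e_i, f_j) = δ_ij / 2` and `B (e_i, e_j) = B (f_i, f_j) = 0`.
-/
def Q (h : ℕ) : QuadraticForm ℂ (V h) :=
  ∑ i : Fin h, QuadraticMap.linMulLin
    (LinearMap.proj (Sum.inl i) : V h →ₗ[ℂ] ℂ) (LinearMap.proj (Sum.inr i) : V h →ₗ[ℂ] ℂ)

theorem Q_apply (h : ℕ) (v : V h) : Q h v = ∑ i : Fin h, v (Sum.inl i) * v (Sum.inr i) := by
  simp [Q]

/-- The basis vector `f_i` of `V`. -/
def fVec (h : ℕ) (i : Fin h) : V h := Pi.single (Sum.inr i) 1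

/-- The inclusion of `E` into `V`; it is isometric for the zero form on `E`, because `Q` vanishes on
`E`. -/
def inclE (h : ℕ) : (0 : QuadraticForm ℂ (E h)) →qᵢ Q h where
  toFun a := Sum.elim a 0
  map_add' a b := by ext (i | i) <;> simp
  map_smul' c a := by ext (i | i) <;> simp
  map_app' a := by simp [Q_apply]

/-- `W` is a maximal totally isotropic subspace of `V`: `Q` vanishes on it and its dimension is
`h`, half that of `V`. -/
def IsMaximalIsotropic {h : ℕ} (W : Submodule ℂ (V h)) : Prop :=
  (∀ w ∈ W, Q h w = 0) ∧ Module.finrank ℂ W = h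

/-! ### Pure spinors and the spinor variety -/

/-- The space of spinors `S (V, Q) = Cl (E, Q|_E)`. Since `Q|_E = 0`, it is the exterior algebra
of `E`. -/
abbrev Spinor (h : ℕ) : Type := CliffordAlgebra (0 : QuadraticForm ℂ (E h))

/-- The product in `Cl (V, Q)`, in the order of the indices, of a family of `h` vectors of `V`. -/
def cliffordProd {h : ℕ} (v : Fin h → V h) : CliffordAlgebra (Q h) :=
  (List.ofFn fun i => CliffordAlgebra.ι (Q h) (v i)).prod

/-- The identification `s ↦ s · f` of the space of spinors `Cl (E, Q|_E)` with the left ideal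
`Cl (V, Q) f`, where `f = f_1 ⋯ f_h`. -/
def toIdeal {h : ℕ} (s : Spinor h) : CliffordAlgebra (Q h) :=
  CliffordAlgebra.map (inclE h) s * cliffordProd (fVec h)

/-- `s` is a representative spinor of the maximal totally isotropic subspace `W`: it is not zero,
and `s · f` lies in the right ideal `f_W Cl (V, Q)`, where `f_W` is the product of the vectors in a
basis of `W`. -/
def IsRepresentativeSpinor {h : ℕ} (W : Submodule ℂ (V h)) (s : Spinor h) : Prop :=
  IsMaximalIsotropic W ∧ s ≠ 0 ∧
    ∃ (b : Module.Basis (Fin h) ℂ W) (φ : CliffordAlgebra (Q h)),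
      toIdeal s = cliffordProd (fun i => (b i : V h)) * φ

/-- The affine cone over the spinor variety `S_h`: zero, and the pure spinors (the representative
spinors of the maximal totally isotropic subspaces) that have the parity of `e_1 ⋯ e_h`. These are
the pure spinors in the component that contains the representative spinor `e_1 ⋯ e_h` of `E`, so
that the spaces `[I_h | U]` with `U` skew symmetric belong to it whatever the parity of `h`. -/
def spinorCone (h : ℕ) : Set (Spinor h) :=
  {s | s = 0 ∨ (s ∈ CliffordAlgebra.evenOdd (0 : QuadraticForm ℂ (E h)) (h : ZMod 2) ∧
    ∃ W : Submodule ℂ (V h), IsRepresentativeSpinor W s)}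

/-! ### Affine tangent spaces -/

section Tangent

variable {M : Type*} [AddCommGroup M] [Module ℂ M]

/-- The value at `x` of a polynomial function on the vector space `M`, i.e. of a polynomial in
linear forms on `M`. -/
def polyEval (p : MvPolynomial (Module.Dual ℂ M) ℂ) (x : M) : ℂ :=
  MvPolynomial.eval (fun ℓ : Module.Dual ℂ M => ℓ x) p

/-- The differential at `x` of a polynomial function on the vector space `M` (chain rule). -/
def polyDiff (p : MvPolynomial (Module.Dual ℂ M) ℂ) (x : M) : Module.Dual ℂ M :=
  ∑ ℓ ∈ p.vars, polyEval (MvPolynomial.pderiv ℓ p) x • ℓ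

/-- The affine tangent space at the point of a projective variety represented by `x`, where `X` is
the affine cone over the variety: the vectors that are annihilated by the differentials at `x` of
all polynomial functions vanishing on `X`. -/
def affineTangentSpace (X : Set M) (x : M) : Submodule ℂ M where
  carrier := {v | ∀ p : MvPolynomial (Module.Dual ℂ M) ℂ,
    (∀ y ∈ X, polyEval p y = 0) → polyDiff p x v = 0}
  zero_mem' p _ := map_zero _
  add_mem' {v w} hv hw p hp := by rw [map_add, hv p hp, hw p hp, add_zero]
  smul_mem' c v hv p hp := by rw [map_smul, hv p hp, smul_zero]

end Tangent

/-! ### The points -/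

/-- The subspace of `V` spanned by the rows of the `h` by `2 h` matrix `[I_h | U]`. -/
def rowSpace {h : ℕ} (U : Matrix (Fin h) (Fin h) ℂ) : Submodule ℂ (V h) :=
  Submodule.span ℂ (Set.range (Matrix.fromCols (1 : Matrix (Fin h) (Fin h) ℂ) U).row)

/-- For `12 ≤ h`, the skew symmetric matrix of size `h` whose upper left corner of size `12` is
made up of the six diagonal blocks `(0, t_b; -t_b, 0)`, and whose other entries are zero. -/
def blockMatrix (h : ℕ) (t : Fin 6 → ℂ) : Matrix (Fin h) (Fin h) ℂ :=
  Matrix.of fun i j => ∑ b : Fin 6,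
    if i.val = 2 * b.val ∧ j.val = 2 * b.val + 1 then t b
    else if i.val = 2 * b.val + 1 ∧ j.val = 2 * b.val then - t b
    else 0

/-- The matrices `O`, `J_6` (all blocks with `t = 1`) and `K_6` (blocks with `t = 2, …, 7`), each
padded by zeros to size `h`. -/
def pointMatrix (h : ℕ) : Fin 3 → Matrix (Fin h) (Fin h) ℂ :=
  ![0, blockMatrix h fun _ => 1, blockMatrix h fun b => (b.val : ℂ) + 2]

end SpinorVariety

end

/-!
The Clifford algebra `Cl (V, Q)` acts on the spinors `Λ E`: `e_i` by exterior multiplication, `f_i`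
by contraction. The identification of `Λ E` with `Cl (V, Q) f` is equivariant and injective, so a
representative spinor of `W` is killed by all vectors of `W`
(`IsRepresentativeSpinor.act_eq_zero`).

*Upper bound for the tangent spaces.* For a pure spinor `s` of `W` and linear forms `α`, `β`, the
linear forms `v ↦ α (v s)` and `v ↦ β (v s)` on `V` vanish on `W`, so they are represented by
vectors of `W^⊥ = W`, which are orthogonal to each other. This is Cartan's quadratic relation
`∑ α (e_i s) β (f_i s) + α (f_i s) β (e_i s) = 0` (`IsRepresentativeSpinor.cartan`). Let `W` be the
graph of a skew-symmetric `U`, with rows `w_i`. The derivative of the relations at `s` says that a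
tangent vector `t` has `w_j t` in the span of the `f_i s`; hence `t` differs by an element of
`Λ² F s` from a spinor killed by all `w_j`, and such a spinor is a multiple of `s`
(`eq_zero_of_topCoeff`). So the tangent space is contained in `ℂ s + Λ² F s`
(`exists_eq_of_mem_affineTangentSpace`).

*Independence.* Let `t_k = c_k s_k + ∑ κ_k^{ij} f_i f_j s_k` be tangent vectors with
`t_0 + t_1 + t_2 = 0`. The coordinates of the `t_k` are evaluated by means of `wordCoeff`. A torus
that fixes the three points makes most contributions to a coordinate vanish. If `p, q` do not form a
block, the coordinate given by `p`, `q` and one further block of parameter `τ` yields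
`κ_1^{pq} + τ κ_2^{pq} = 0` (up to nonzero factors), for at least two values of `τ`, so
`κ_1^{pq} = κ_2^{pq} = 0` (`wordCoeff_pair`). The coordinates given by sets of at least two blocks,
in which `t_0` does not take part, give a linear system of rank 14 for the remaining 14 coefficients
of `t_1` and `t_2` (`wordCoeff_blockWord_tangent`, `coeff_eq_zero`). So `t_1 = t_2 = 0`, and then
`t_0 = 0`.
-/

noncomputable section

namespace SpinorVariety

/-! ### The spin representation -/

/-- The basis vector `e_i` of `V`. -/
def eVec (h : ℕ) (i : Fin h) : V h := Pi.single (Sum.inl i) 1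

/-- The polar form of `Q`, in coordinates. -/
def pol {h : ℕ} (u v : V h) : ℂ :=
  ∑ i : Fin h, (u (Sum.inl i) * v (Sum.inr i) + u (Sum.inr i) * v (Sum.inl i))

/-- The `F`-component of a vector of `V`, as a linear form on `E` by means of the polar form. -/
def dualPart (h : ℕ) : V h →ₗ[ℂ] Module.Dual ℂ (E h) :=
  ∑ i : Fin h, (LinearMap.proj (Sum.inr i) : V h →ₗ[ℂ] ℂ).smulRight
    (LinearMap.proj i : E h →ₗ[ℂ] ℂ)

/-- The action of a vector of `V` on spinors: the `E`-component acts by exterior multiplication,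
the `F`-component by contraction. -/
def act {h : ℕ} : V h →ₗ[ℂ] Spinor h →ₗ[ℂ] Spinor h :=
  (LinearMap.mul ℂ (Spinor h)).comp
      ((CliffordAlgebra.ι (0 : QuadraticForm ℂ (E h))).comp (LinearMap.funLeft ℂ ℂ Sum.inl)) +
    CliffordAlgebra.contractLeft.comp (dualPart h)

variable {h : ℕ}

theorem inclE_inl (a : E h) (i : Fin h) : inclE h a (Sum.inl i) = a i := rfl

theorem inclE_inr (a : E h) (i : Fin h) : inclE h a (Sum.inr i) = 0 := rfl

theorem dualPart_apply (v : V h) (a : E h) : dualPart h v a = ∑ i, v (Sum.inr i) * a i := by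
  simp [dualPart]

theorem act_apply (v : V h) (x : Spinor h) :
    act v x = CliffordAlgebra.ι (0 : QuadraticForm ℂ (E h)) (fun i => v (Sum.inl i)) * x +
      CliffordAlgebra.contractLeft (dualPart h v) x := rfl

theorem act_act_self (v : V h) (x : Spinor h) : act v (act v x) = Q h v • x := by
  have hz : ∀ a : E h, CliffordAlgebra.ι (0 : QuadraticForm ℂ (E h)) a *
      (CliffordAlgebra.ι (0 : QuadraticForm ℂ (E h)) a * x) = 0 := fun a => by
    rw [← mul_assoc, CliffordAlgebra.ι_sq_scalar]; simp
  simp only [act_apply, map_add, CliffordAlgebra.contractLeft_ι_mul, hz,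
    CliffordAlgebra.contractLeft_contractLeft, dualPart_apply, Q_apply]
  rw [show (∑ i, v (Sum.inr i) * v (Sum.inl i)) = ∑ i, v (Sum.inl i) * v (Sum.inr i) from
    Finset.sum_congr rfl fun i _ => mul_comm _ _]
  abel

theorem polar_Q (u v : V h) : QuadraticMap.polar (Q h) u v = pol u v := by
  simp only [QuadraticMap.polar, Q_apply, pol, ← Finset.sum_sub_distrib]
  exact Finset.sum_congr rfl fun i _ => by simp; ring

/-- The spin representation of `Cl (V, Q)` on the space of spinors. -/
def spinRep (h : ℕ) : CliffordAlgebra (Q h) →ₐ[ℂ] Module.End ℂ (Spinor h) :=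
  CliffordAlgebra.lift (Q h) ⟨act, fun v => LinearMap.ext fun x => by
    simpa [Algebra.algebraMap_eq_smul_one] using act_act_self v x⟩

@[simp]
theorem spinRep_ι (v : V h) : spinRep h (CliffordAlgebra.ι (Q h) v) = act v := by
  simp [spinRep]

/-- The Clifford relation for the action of vectors on spinors. -/
theorem act_act (u v : V h) (x : Spinor h) : act u (act v x) = pol u v • x - act v (act u x) := by
  have := congrArg (fun a => spinRep h a x) (CliffordAlgebra.ι_mul_ι_add_swap (Q := Q h) u v)
  simp only [map_add, map_mul, spinRep_ι, LinearMap.add_apply, Module.End.mul_apply,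
    AlgHom.commutes, polar_Q] at this
  rw [eq_sub_iff_add_eq, this]
  simp [Algebra.algebraMap_eq_smul_one]

theorem pol_comm (u v : V h) : pol u v = pol v u :=
  Finset.sum_congr rfl fun i _ => by ring

theorem pol_add_left (u v w : V h) : pol (u + v) w = pol u w + pol v w := by
  simp only [pol, ← Finset.sum_add_distrib]
  exact Finset.sum_congr rfl fun i _ => by simp; ring

theorem pol_add_right (u v w : V h) : pol u (v + w) = pol u v + pol u w := by
  rw [pol_comm, pol_add_left, pol_comm v, pol_comm w]

theorem pol_smul_left (c : ℂ) (u v : V h) : pol (c • u) v = c * pol u v := by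
  simp only [pol, Finset.mul_sum]
  exact Finset.sum_congr rfl fun i _ => by simp; ring

theorem pol_smul_right (c : ℂ) (u v : V h) : pol u (c • v) = c * pol u v := by
  rw [pol_comm, pol_smul_left, pol_comm]

theorem pol_eVec (i : Fin h) (v : V h) : pol (eVec h i) v = v (Sum.inr i) := by
  simp [pol, eVec, Pi.single_apply]

theorem pol_fVec (i : Fin h) (v : V h) : pol (fVec h i) v = v (Sum.inl i) := by
  simp [pol, fVec, Pi.single_apply]

theorem fVec_inl (i j : Fin h) : fVec h i (Sum.inl j) = 0 := by simp [fVec]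

theorem fVec_inr (i j : Fin h) : fVec h i (Sum.inr j) = if j = i then 1 else 0 := by
  simp [fVec, Pi.single_apply]

theorem eVec_inr (i j : Fin h) : eVec h i (Sum.inr j) = 0 := by simp [eVec]

theorem eVec_inl (i j : Fin h) : eVec h i (Sum.inl j) = if j = i then 1 else 0 := by
  simp [eVec, Pi.single_apply]

theorem pol_eVec_eVec (i j : Fin h) : pol (eVec h i) (eVec h j) = 0 := by
  rw [pol_eVec, eVec_inr]

theorem pol_fVec_fVec (i j : Fin h) : pol (fVec h i) (fVec h j) = 0 := by
  rw [pol_fVec, fVec_inl]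

theorem pol_eVec_fVec (i j : Fin h) : pol (eVec h i) (fVec h j) = if i = j then 1 else 0 := by
  rw [pol_eVec, fVec_inr]

theorem pol_fVec_eVec (i j : Fin h) : pol (fVec h i) (eVec h j) = if i = j then 1 else 0 := by
  rw [pol_fVec, eVec_inl]

/-- The product of the vectors of a list in `Cl (V, Q)`. Lists allow inductions that the products
over `Fin h` of `cliffordProd` do not. -/
def listProd (l : List (V h)) : CliffordAlgebra (Q h) :=
  (l.map (CliffordAlgebra.ι (Q h))).prod

theorem cliffordProd_eq (v : Fin h → V h) : cliffordProd v = listProd (List.ofFn v) := by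
  simp [cliffordProd, listProd, List.map_ofFn, Function.comp_def]

/-- A vector of a list of mutually orthogonal isotropic vectors annihilates their product. -/
theorem ι_mul_listProd {l : List (V h)} (hQ : ∀ u ∈ l, Q h u = 0)
    (hpol : ∀ u ∈ l, ∀ v ∈ l, pol u v = 0) {u : V h} (hu : u ∈ l) :
    CliffordAlgebra.ι (Q h) u * listProd l = 0 := by
  induction l with
  | nil => simp at hu
  | cons v l ih =>
    simp only [listProd, List.map_cons, List.prod_cons, ← mul_assoc]
    rcases List.mem_cons.1 hu with rfl | hu'
    · rw [CliffordAlgebra.ι_sq_scalar, hQ u hu]; simp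
    · rw [CliffordAlgebra.ι_mul_ι_comm, polar_Q, hpol u hu v (by simp), map_zero, zero_sub,
        neg_mul, mul_assoc, neg_eq_zero]
      have := ih (fun w hw => hQ w (List.mem_cons_of_mem _ hw))
        (fun w hw w' hw' => hpol w (List.mem_cons_of_mem _ hw) w' (List.mem_cons_of_mem _ hw')) hu'
      rw [listProd] at this
      rw [this, mul_zero]

theorem listProd_mul_ι {l : List (V h)} (hQ : ∀ u ∈ l, Q h u = 0)
    (hpol : ∀ u ∈ l, ∀ v ∈ l, pol u v = 0) {u : V h} (hu : u ∈ l) :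
    listProd l * CliffordAlgebra.ι (Q h) u = 0 := by
  have := congrArg CliffordAlgebra.reverse (ι_mul_listProd (l := l.reverse)
    (fun u hu => hQ u (by simpa using hu))
    (fun u hu v hv => hpol u (by simpa using hu) v (by simpa using hv)) (u := u)
    (by simpa using hu))
  rw [CliffordAlgebra.reverse.map_mul, CliffordAlgebra.reverse_ι, listProd,
    CliffordAlgebra.reverse_prod_map_ι, map_zero] at this
  simpa [listProd, List.map_reverse] using this

theorem Q_fVec (i : Fin h) : Q h (fVec h i) = 0 := by simp [Q_apply, fVec_inl]

theorem Q_eVec (i : Fin h) : Q h (eVec h i) = 0 := by simp [Q_apply, eVec_inr]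

theorem ι_fVec_mul (i : Fin h) :
    CliffordAlgebra.ι (Q h) (fVec h i) * cliffordProd (fVec h) = 0 := by
  rw [cliffordProd_eq]
  apply ι_mul_listProd
  · simp [List.mem_ofFn, Q_fVec]
  · simp [List.mem_ofFn, pol_fVec_fVec]
  · simp [List.mem_ofFn]

theorem mul_ι_fVec (i : Fin h) :
    cliffordProd (fVec h) * CliffordAlgebra.ι (Q h) (fVec h i) = 0 := by
  rw [cliffordProd_eq]
  apply listProd_mul_ι
  · simp [List.mem_ofFn, Q_fVec]
  · simp [List.mem_ofFn, pol_fVec_fVec]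
  · simp [List.mem_ofFn]

theorem vec_eq (v : V h) :
    v = (Sum.elim (fun i => v (Sum.inl i)) 0 : V h) + ∑ i, v (Sum.inr i) • fVec h i := by
  funext k
  rcases k with k | k <;> simp [fVec, Pi.single_apply]

/-- The identification of the spinors with the left ideal `Cl (V, Q) f` is equivariant. -/
theorem toIdeal_act (v : V h) (s : Spinor h) :
    toIdeal (act v s) = CliffordAlgebra.ι (Q h) v * toIdeal s := by
  have hf : CliffordAlgebra.ι (Q h) (∑ i, v (Sum.inr i) • fVec h i) *
      cliffordProd (fVec h) = 0 := by
    simp [Finset.sum_mul, ι_fVec_mul]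
  have hv : ∀ m : E h, pol (∑ i, v (Sum.inr i) • fVec h i) (inclE h m) = dualPart h v m := by
    intro m
    rw [dualPart_apply, pol]
    refine Finset.sum_congr rfl fun i _ => ?_
    simp [fVec, Pi.single_apply, inclE_inl, inclE_inr]
  -- A vector of `F` kills `f`, so moving it through `s` to the right leaves the contraction of `s`.
  have key : ∀ s : Spinor h, toIdeal (CliffordAlgebra.contractLeft (dualPart h v) s) =
      CliffordAlgebra.ι (Q h) (∑ i, v (Sum.inr i) • fVec h i) * toIdeal s := by
    intro s
    induction s using CliffordAlgebra.left_induction with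
    | algebraMap r =>
      rw [toIdeal, toIdeal, CliffordAlgebra.contractLeft_algebraMap, AlgHom.commutes,
        Algebra.left_comm, hf]
      simp
    | add x y hx hy =>
      simp only [toIdeal, map_add, add_mul, mul_add] at *
      rw [hx, hy]
    | ι_mul x m hx =>
      rw [CliffordAlgebra.contractLeft_ι_mul]
      simp only [toIdeal, map_sub, map_smul, map_mul, sub_mul, CliffordAlgebra.map_apply_ι,
        mul_assoc] at *
      rw [hx, ← mul_assoc (CliffordAlgebra.ι (Q h) (∑ i, v (Sum.inr i) • fVec h i))
        (CliffordAlgebra.ι (Q h) (inclE h m)),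
        CliffordAlgebra.ι_mul_ι_comm _ (inclE h m), polar_Q, hv, sub_mul, ← Algebra.smul_def,
        smul_mul_assoc, mul_assoc]
  conv_rhs => rw [vec_eq v]
  rw [map_add, add_mul, ← key, act_apply]
  simp only [toIdeal, map_add, add_mul, map_mul, CliffordAlgebra.map_apply_ι, mul_assoc]
  rfl

theorem toIdeal_spinRep (a : CliffordAlgebra (Q h)) (s : Spinor h) :
    toIdeal (spinRep h a s) = a * toIdeal s := by
  induction a using CliffordAlgebra.induction generalizing s with
  | algebraMap r => simp [toIdeal, Algebra.algebraMap_eq_smul_one]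
  | ι v => rw [spinRep_ι, toIdeal_act]
  | mul a b ha hb => rw [map_mul, Module.End.mul_apply, ha, hb, mul_assoc]
  | add a b ha hb =>
    rw [map_add, LinearMap.add_apply, add_mul, ← ha, ← hb]
    simp [toIdeal, add_mul]

theorem toIdeal_one : toIdeal (1 : Spinor h) = cliffordProd (fVec h) := by simp [toIdeal]

theorem spinRep_map (s x : Spinor h) : spinRep h (CliffordAlgebra.map (inclE h) s) x = s * x := by
  induction s using CliffordAlgebra.induction generalizing x with
  | algebraMap r => simp [Algebra.algebraMap_eq_smul_one]
  | ι v =>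
    have : dualPart h (inclE h v) = 0 := by
      ext a; simp [dualPart_apply, inclE_inr]
    rw [CliffordAlgebra.map_apply_ι, spinRep_ι, act_apply, this]
    simp [inclE_inl]
  | mul a b ha hb => rw [map_mul, map_mul, Module.End.mul_apply, ha, hb, mul_assoc]
  | add a b ha hb => rw [map_add, map_add, LinearMap.add_apply, ha, hb, add_mul]

theorem act_fVec_one (i : Fin h) : act (fVec h i) (1 : Spinor h) = 0 := by
  have : (fun j => fVec h i (Sum.inl j)) = (0 : E h) := funext fun j => fVec_inl i j
  rw [act_apply, this]; simp

/-! ### Words of vectors -/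

/-- The product of the vectors of a list, acting on a spinor; the last vector acts first. -/
def actList (l : List (V h)) (x : Spinor h) : Spinor h := l.foldr (fun v y => act v y) x

@[simp] theorem actList_nil (x : Spinor h) : actList [] x = x := rfl

@[simp] theorem actList_cons (v : V h) (l : List (V h)) (x : Spinor h) :
    actList (v :: l) x = act v (actList l x) := rfl

theorem actList_append (l l' : List (V h)) (x : Spinor h) :
    actList (l ++ l') x = actList l (actList l' x) := by
  simp [actList]

theorem actList_eq (l : List (V h)) (x : Spinor h) : actList l x = spinRep h (listProd l) x := by
  induction l with
  | nil => simp [listProd]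
  | cons v l ih => simp [ih, listProd]

theorem actList_add (l : List (V h)) (x y : Spinor h) :
    actList l (x + y) = actList l x + actList l y := by simp [actList_eq]

theorem actList_smul (l : List (V h)) (c : ℂ) (x : Spinor h) :
    actList l (c • x) = c • actList l x := by simp [actList_eq]

theorem toIdeal_actList (l : List (V h)) (s : Spinor h) :
    toIdeal (actList l s) = listProd l * toIdeal s := by
  rw [actList_eq, toIdeal_spinRep]

/-- A word in letters orthogonal to an isotropic vector that kills `x` is killed by it as well. -/
theorem act_actList_eq_zero {u : V h} {x : Spinor h} (hx : act u x = 0) {l : List (V h)}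
    (hl : ∀ v ∈ l, pol u v = 0) : act u (actList l x) = 0 := by
  induction l with
  | nil => simpa
  | cons v l ih =>
    rw [actList_cons, act_act, hl v (by simp), ih fun w hw => hl w (by simp [hw])]
    simp

/-- If `{f_i, w_j} = δ_ij`, then for distinct indices `i_1, …, i_m` the word
`f_{i_1} ⋯ f_{i_m} w_{i_m} ⋯ w_{i_1}` fixes every spinor killed by all the `f_i`. -/
theorem actList_fVec_reverse {w : Fin h → V h}
    (hw : ∀ i j, pol (fVec h i) (w j) = if i = j then 1 else 0)
    {x : Spinor h} (hx : ∀ i, act (fVec h i) x = 0) {l : List (Fin h)} (hl : l.Nodup) :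
    actList (l.map (fVec h)) (actList (l.reverse.map w) x) = x := by
  induction l using List.reverseRecOn with
  | nil => simp
  | append_singleton l i ih =>
    have hl' := List.nodup_append.1 hl
    rw [List.map_append, actList_append, List.reverse_append, List.map_append, actList_append]
    simp only [List.map_cons, List.map_nil, actList_cons, actList_nil, List.reverse_cons,
      List.reverse_nil, List.nil_append]
    rw [act_act, hw, if_pos rfl, one_smul, act_actList_eq_zero (hx i), map_zero, sub_zero,
      ih hl'.1]
    intro v hv
    obtain ⟨j, hj, rfl⟩ := List.mem_map.1 hv
    rw [hw, if_neg]
    rintro rfl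
    exact hl'.2.2 i (by simpa using hj) i (by simp) rfl

theorem map_finRange (v : Fin h → V h) : (List.finRange h).map v = List.ofFn v :=
  (List.ofFn_eq_map).symm

/-- The identification of spinors with elements of the left ideal `Cl (V, Q) f` is injective:
acting on `e_h ⋯ e_1` by `s f` gives back `s`. -/
theorem toIdeal_injective : Function.Injective (toIdeal (h := h)) := by
  refine Function.LeftInverse.injective
    (g := fun a => spinRep h a (actList ((List.finRange h).reverse.map (eVec h)) 1)) fun s => ?_
  have := actList_fVec_reverse (w := eVec h) pol_fVec_eVec act_fVec_one (List.nodup_finRange h)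
  rw [map_finRange, actList_eq (List.ofFn _), ← cliffordProd_eq] at this
  simp only [toIdeal]
  rw [map_mul, Module.End.mul_apply, this, spinRep_map, mul_one]

/-! ### The coefficient of `e_1 ⋯ e_h` -/

/-- Up to sign, the coefficient of `e_1 ⋯ e_h` in a spinor: the scalar part of its contraction with
`f_1, …, f_h`. -/
def topCoeff (h : ℕ) : Spinor h →ₗ[ℂ] ℂ :=
  (ExteriorAlgebra.algebraMapInv (R := ℂ) (M := E h)).toLinearMap ∘ₗ
    spinRep h (cliffordProd (fVec h))

theorem topCoeff_apply (x : Spinor h) : topCoeff h x =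
    ExteriorAlgebra.algebraMapInv (spinRep h (cliffordProd (fVec h)) x) := rfl

theorem topCoeff_act_fVec (i : Fin h) (x : Spinor h) : topCoeff h (act (fVec h i) x) = 0 := by
  rw [topCoeff_apply, ← spinRep_ι, ← Module.End.mul_apply, ← map_mul, mul_ι_fVec]
  simp

theorem topCoeff_act {g : V h} (hg : ∀ i, g (Sum.inl i) = 0) (x : Spinor h) :
    topCoeff h (act g x) = 0 := by
  have : g = ∑ i, g (Sum.inr i) • fVec h i := by
    funext k
    rcases k with k | k <;> simp [fVec, Pi.single_apply, hg]
  rw [this]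
  simp [topCoeff_act_fVec]

/-- The word `f_1 ⋯ f_h e_h ⋯ e_1` acts as the projection onto the scalars. -/
theorem actList_fVec_eVec (x : Spinor h) :
    actList ((List.finRange h).map (fVec h)) (actList ((List.finRange h).reverse.map (eVec h)) x) =
      algebraMap ℂ (Spinor h) (ExteriorAlgebra.algebraMapInv x) := by
  induction x using CliffordAlgebra.left_induction with
  | algebraMap r =>
    have := actList_fVec_reverse (w := eVec h) pol_fVec_eVec act_fVec_one (List.nodup_finRange h)
    rw [Algebra.algebraMap_eq_smul_one, actList_smul, actList_smul, this, map_smul, map_one]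
    simp [Algebra.algebraMap_eq_smul_one]
  | add x y hx hy => rw [actList_add, actList_add, hx, hy, map_add, map_add]
  | ι_mul x m hx =>
    have h1 : CliffordAlgebra.ι (0 : QuadraticForm ℂ (E h)) m * x = act (inclE h m) x := by
      rw [← spinRep_ι, ← CliffordAlgebra.map_apply_ι, spinRep_map]
    have h2 : inclE h m = ∑ i, m i • eVec h i := by
      funext k
      rcases k with k | k <;> simp [eVec, Pi.single_apply, inclE_inl, inclE_inr]
    have h3 : ∀ i, actList ((List.finRange h).reverse.map (eVec h)) (act (eVec h i) x) = 0 := by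
      intro i
      rw [actList_eq, ← spinRep_ι, ← Module.End.mul_apply, ← map_mul, listProd_mul_ι]
      · simp
      · simp [Q_eVec]
      · simp [pol_eVec_eVec]
      · simp
    have h4 : ExteriorAlgebra.algebraMapInv
        (CliffordAlgebra.ι (0 : QuadraticForm ℂ (E h)) m) = 0 := by
      simp [ExteriorAlgebra.algebraMapInv]
    rw [map_mul, h4, h1, h2]
    simp only [map_sum, map_smul, LinearMap.sum_apply, LinearMap.smul_apply]
    rw [actList_eq _ (∑ i, _), map_sum]
    simp only [map_smul, ← actList_eq, h3]
    simp [actList_eq]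

/-- A form of the irreducibility of the spin representation: a spinor `x` is zero as soon as no
word in the vectors of `V` maps it to a spinor with a nonzero coefficient of `e_1 ⋯ e_h`. -/
theorem eq_zero_of_topCoeff_actList {x : Spinor h}
    (hx : ∀ l : List (V h), topCoeff h (actList l x) = 0) : x = 0 := by
  -- Induction on the number of `f_i` that may not kill `y`: it decreases from `y` to `f_k y`, which
  -- is thus zero. If all `f_i` kill `y`, then `y` is a scalar, tested by the word `e_h ⋯ e_1`.
  suffices H : ∀ K : Finset (Fin h), ∀ y : Spinor h, (∀ l, topCoeff h (actList l y) = 0) →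
      (∀ i, i ∉ K → act (fVec h i) y = 0) → y = 0 from
    H Finset.univ x hx (by simp)
  intro K
  induction K using Finset.induction_on with
  | empty =>
    intro y hy hK
    have hfix := actList_fVec_reverse (w := eVec h) pol_fVec_eVec (x := y)
      (fun i => hK i (by simp)) (List.nodup_finRange h)
    have hscal := actList_fVec_eVec y
    have := hy ((List.finRange h).reverse.map (eVec h))
    rw [topCoeff_apply, cliffordProd_eq, ← map_finRange, ← actList_eq, hfix] at this
    rw [this, map_zero] at hscal
    rw [← hfix, hscal]
  | insert k K hk ih =>
    intro y hy hK
    have hs : ∀ (v : V h) (l : List (V h)), topCoeff h (actList l (act v y)) = 0 := fun v l => by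
      simpa [actList_append] using hy (l ++ [v])
    refine ih y hy fun i hi => ?_
    by_cases hik : i = k
    · subst hik
      refine ih _ (hs _) fun j hj => ?_
      by_cases hji : j = i
      · subst hji
        rw [act_act_self, Q_fVec, zero_smul]
      · rw [act_act, hK j (by simp [hji, hj]), pol_fVec_fVec]; simp
    · exact hK i (by simp [hik, hi])

/-! ### The spinors of the graph of a skew-symmetric matrix -/

/-- The `i`-th row of the matrix `[I | U]`, that is, the vector `e_i + ∑ u_ij f_j`. -/
def rowVec (U : Matrix (Fin h) (Fin h) ℂ) (i : Fin h) : V h :=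
  Matrix.fromCols (1 : Matrix (Fin h) (Fin h) ℂ) U i

theorem rowVec_inl (U : Matrix (Fin h) (Fin h) ℂ) (i j : Fin h) :
    rowVec U i (Sum.inl j) = if i = j then 1 else 0 := by
  simp [rowVec, Matrix.one_apply]

theorem rowVec_inr (U : Matrix (Fin h) (Fin h) ℂ) (i j : Fin h) :
    rowVec U i (Sum.inr j) = U i j := by
  simp [rowVec]

theorem rowVec_eq (U : Matrix (Fin h) (Fin h) ℂ) (i : Fin h) :
    rowVec U i = eVec h i + ∑ j, U i j • fVec h j := by
  funext k
  rcases k with k | k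
  · simp [rowVec_inl, eVec_inl, fVec_inl, eq_comm]
  · simp [rowVec_inr, eVec_inr, fVec_inr]

theorem rowVec_mem (U : Matrix (Fin h) (Fin h) ℂ) (i : Fin h) : rowVec U i ∈ rowSpace U :=
  Submodule.subset_span ⟨i, rfl⟩

theorem pol_fVec_rowVec (U : Matrix (Fin h) (Fin h) ℂ) (i j : Fin h) :
    pol (fVec h i) (rowVec U j) = if i = j then 1 else 0 := by
  rw [pol_fVec, rowVec_inl]
  simp [eq_comm]

theorem pol_rowVec_rowVec {U : Matrix (Fin h) (Fin h) ℂ} (hU : ∀ i j, U j i = -U i j)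
    (i j : Fin h) : pol (rowVec U i) (rowVec U j) = 0 := by
  simp [pol, rowVec_inl, rowVec_inr, Finset.sum_add_distrib, hU i j]

/-- A spinor killed by all rows of `[I | U]` whose coefficient of `e_1 ⋯ e_h` vanishes is zero. -/
theorem eq_zero_of_topCoeff {U : Matrix (Fin h) (Fin h) ℂ} {x : Spinor h}
    (hx : ∀ i, act (rowVec U i) x = 0) (h0 : topCoeff h x = 0) : x = 0 := by
  refine eq_zero_of_topCoeff_actList fun l => ?_
  -- A letter in `F` is moved to the front of a word, where it gives zero, at the cost of words
  -- that are shorter by two letters.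
  have move : ∀ (n : ℕ), (∀ l : List (V h), l.length < n → topCoeff h (actList l x) = 0) →
      ∀ (g : V h), (∀ i, g (Sum.inl i) = 0) → ∀ (l₁ l₂ : List (V h)), l₁.length + l₂.length < n →
        topCoeff h (actList (l₁ ++ g :: l₂) x) = 0 := by
    intro n hn g hg l₁
    induction l₁ using List.reverseRecOn with
    | nil => intro l₂ _; exact topCoeff_act hg _
    | append_singleton l₁ v ih =>
      intro l₂ hl
      have hl' : l₁.length + 1 + l₂.length < n := by simpa using hl
      have h1 := ih (v :: l₂) (by simp; omega)
      have h2 := hn (l₁ ++ l₂) (by simp; omega)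
      rw [actList_append] at h1 h2
      rw [List.append_assoc, actList_append]
      simp only [List.singleton_append, actList_cons] at h1 ⊢
      rw [act_act, sub_eq_add_neg, actList_add, actList_smul, map_add, map_smul, h2,
        ← neg_one_smul ℂ, actList_smul, map_smul, h1]
      simp
  suffices H : ∀ n : ℕ, ∀ l : List (V h), l.length = n → topCoeff h (actList l x) = 0 from
    H _ l rfl
  intro n
  induction n using Nat.strong_induction_on with
  | _ n ih =>
    intro l hl
    rcases List.eq_nil_or_concat' l with rfl | ⟨l', v, rfl⟩
    · exact h0
    · set g : V h := v - ∑ i, v (Sum.inl i) • rowVec U i with hg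
      have hv : act v x = act g x := by
        simp [hg, hx]
      have hg0 : ∀ i, g (Sum.inl i) = 0 := fun i => by
        simp [hg, rowVec_inl]
      have := move n (fun l hl => ih _ hl l rfl) g hg0 l' [] (by simp at hl ⊢; omega)
      rw [actList_append] at this ⊢
      simpa [hv] using this

theorem topCoeff_ne_zero {U : Matrix (Fin h) (Fin h) ℂ} {s : Spinor h}
    (hs : ∀ i, act (rowVec U i) s = 0) (h0 : s ≠ 0) : topCoeff h s ≠ 0 :=
  fun hc => h0 (eq_zero_of_topCoeff hs hc)

/-! ### Representative spinors -/

theorem pol_eq_zero {W : Submodule ℂ (V h)} (hW : ∀ w ∈ W, Q h w = 0) {u v : V h} (hu : u ∈ W)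
    (hv : v ∈ W) : pol u v = 0 := by
  rw [← polar_Q, QuadraticMap.polar, hW _ (W.add_mem hu hv), hW _ hu, hW _ hv]
  simp

/-- A representative spinor of `W` is killed by all vectors of `W`. -/
theorem IsRepresentativeSpinor.act_eq_zero {W : Submodule ℂ (V h)} {s : Spinor h}
    (hs : IsRepresentativeSpinor W s) {w : V h} (hw : w ∈ W) : act w s = 0 := by
  obtain ⟨⟨hW, -⟩, -, b, φ, hφ⟩ := hs
  apply toIdeal_injective
  have hz : toIdeal (0 : Spinor h) = 0 := by simp [toIdeal]
  rw [toIdeal_act, hφ, ← mul_assoc, hz]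
  have hb : ∀ i, CliffordAlgebra.ι (Q h) (b i : V h) * cliffordProd (fun i => (b i : V h)) = 0 := by
    intro i
    rw [cliffordProd_eq]
    apply ι_mul_listProd
    · simp only [List.mem_ofFn]
      rintro u ⟨j, rfl⟩
      exact hW _ (b j).2
    · simp only [List.mem_ofFn]
      rintro u ⟨j, rfl⟩ v ⟨k, rfl⟩
      exact pol_eq_zero hW (b j).2 (b k).2
    · simp [List.mem_ofFn]
  have : w = ∑ i, b.repr ⟨w, hw⟩ i • (b i : V h) := by
    have := congrArg (W.subtype) (b.sum_repr ⟨w, hw⟩)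
    rw [map_sum] at this
    simpa only [map_smul, Submodule.subtype_apply] using this.symm
  rw [this, map_sum, Finset.sum_mul]
  simp [hb]

theorem linearIndependent_rowVec (U : Matrix (Fin h) (Fin h) ℂ) :
    LinearIndependent ℂ (rowVec U) := by
  rw [Fintype.linearIndependent_iff]
  intro c hc i
  have := congrFun hc (Sum.inl i)
  simpa [rowVec_inl] using this

theorem rowSpace_eq (U : Matrix (Fin h) (Fin h) ℂ) :
    rowSpace U = Submodule.span ℂ (Set.range (rowVec U)) := rfl

theorem isMaximalIsotropic_rowSpace {U : Matrix (Fin h) (Fin h) ℂ} (hU : ∀ i j, U j i = -U i j) :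
    IsMaximalIsotropic (rowSpace U) := by
  refine ⟨fun w hw => ?_, ?_⟩
  · rw [rowSpace_eq, Submodule.mem_span_range_iff_exists_fun] at hw
    obtain ⟨c, rfl⟩ := hw
    have h0 : pol (∑ i, c i • rowVec U i) (∑ i, c i • rowVec U i) = 0 := by
      have hr : ∀ (u : V h) (T : Finset (Fin h)), (∀ j, pol u (rowVec U j) = 0) →
          pol u (∑ i ∈ T, c i • rowVec U i) = 0 := by
        intro u T hu
        induction T using Finset.induction_on with
        | empty => simp [pol]
        | insert a T ha ih => rw [Finset.sum_insert ha, pol_add_right, pol_smul_right, hu, ih]; simp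
      refine hr _ _ fun j => ?_
      rw [pol_comm]
      exact hr _ _ fun k => pol_rowVec_rowVec hU j k
    rw [← polar_Q, QuadraticMap.polar_self] at h0
    simpa using h0
  · rw [rowSpace_eq, finrank_span_eq_card (linearIndependent_rowVec U), Fintype.card_fin]

theorem contractLeft_mem_evenOdd (d : Module.Dual ℂ (E h)) (n : ZMod 2) {x : Spinor h}
    (hx : x ∈ CliffordAlgebra.evenOdd (0 : QuadraticForm ℂ (E h)) n) :
    CliffordAlgebra.contractLeft d x ∈
      CliffordAlgebra.evenOdd (0 : QuadraticForm ℂ (E h)) (n + 1) := by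
  have step : ∀ (n : ZMod 2) (m₁ m₂ : E h) (x : Spinor h),
      x ∈ CliffordAlgebra.evenOdd (0 : QuadraticForm ℂ (E h)) n →
      CliffordAlgebra.contractLeft d x ∈
        CliffordAlgebra.evenOdd (0 : QuadraticForm ℂ (E h)) (n + 1) →
      CliffordAlgebra.contractLeft d (CliffordAlgebra.ι (0 : QuadraticForm ℂ (E h)) m₁ *
        CliffordAlgebra.ι (0 : QuadraticForm ℂ (E h)) m₂ * x) ∈
        CliffordAlgebra.evenOdd (0 : QuadraticForm ℂ (E h)) (n + 1) := by
    intro n m₁ m₂ x hx hd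
    have mulι : ∀ (k : ZMod 2) (m : E h) (y : Spinor h),
        y ∈ CliffordAlgebra.evenOdd (0 : QuadraticForm ℂ (E h)) k →
        CliffordAlgebra.ι (0 : QuadraticForm ℂ (E h)) m * y ∈
          CliffordAlgebra.evenOdd (0 : QuadraticForm ℂ (E h)) (k + 1) := fun k m y hy => by
      rw [add_comm]
      exact SetLike.mul_mem_graded (CliffordAlgebra.ι_mem_evenOdd_one _ m) hy
    have two : n + 1 + 1 + 1 = n + 1 := by
      rw [add_assoc n 1 1, show (1 + 1 : ZMod 2) = 0 from rfl, add_zero]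
    rw [mul_assoc, CliffordAlgebra.contractLeft_ι_mul, CliffordAlgebra.contractLeft_ι_mul]
    refine Submodule.sub_mem _ (Submodule.smul_mem _ _ (mulι _ _ _ hx)) ?_
    rw [mul_sub]
    refine Submodule.sub_mem _ ?_ ?_
    · rw [mul_smul_comm]
      exact Submodule.smul_mem _ _ (mulι _ _ _ hx)
    · have := mulι _ m₁ _ (mulι _ m₂ _ hd)
      rwa [two] at this
  fin_cases n
  · refine CliffordAlgebra.even_induction _ (fun r => ?_) (fun x y _ _ h1 h2 => ?_)
      (fun m₁ m₂ x hx h1 => ?_) x hx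
    · rw [CliffordAlgebra.contractLeft_algebraMap]; exact Submodule.zero_mem _
    · rw [map_add]; exact Submodule.add_mem _ h1 h2
    · exact step 0 m₁ m₂ x hx h1
  · refine CliffordAlgebra.odd_induction _ (fun r => ?_) (fun x y _ _ h1 h2 => ?_)
      (fun m₁ m₂ x hx h1 => ?_) x hx
    · rw [CliffordAlgebra.contractLeft_ι]
      exact SetLike.algebraMap_mem_graded (CliffordAlgebra.evenOdd (0 : QuadraticForm ℂ (E h))) _
    · rw [map_add]; exact Submodule.add_mem _ h1 h2
    · exact step 1 m₁ m₂ x hx h1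

theorem act_mem_evenOdd (v : V h) {n : ZMod 2} {x : Spinor h}
    (hx : x ∈ CliffordAlgebra.evenOdd (0 : QuadraticForm ℂ (E h)) n) :
    act v x ∈ CliffordAlgebra.evenOdd (0 : QuadraticForm ℂ (E h)) (n + 1) := by
  rw [act_apply]
  refine Submodule.add_mem _ ?_ (contractLeft_mem_evenOdd _ _ hx)
  rw [add_comm]
  exact SetLike.mul_mem_graded (CliffordAlgebra.ι_mem_evenOdd_one _ _) hx

theorem actList_one_mem_evenOdd (l : List (V h)) :
    actList l (1 : Spinor h) ∈
      CliffordAlgebra.evenOdd (0 : QuadraticForm ℂ (E h)) (l.length : ZMod 2) := by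
  induction l with
  | nil => simpa using SetLike.one_mem_graded (CliffordAlgebra.evenOdd (0 : QuadraticForm ℂ (E h)))
  | cons v l ih =>
    rw [actList_cons, List.length_cons, Nat.cast_add, Nat.cast_one]
    exact act_mem_evenOdd v ih

/-- The graph of a skew-symmetric matrix is represented by the spinor `w_1 ⋯ w_h · 1`, where the
`w_i` are the rows of `[I | U]`. Its product with `f` is `w_1 ⋯ w_h f`. -/
theorem exists_mem_spinorCone {U : Matrix (Fin h) (Fin h) ℂ} (hU : ∀ i j, U j i = -U i j) :
    ∃ s ∈ spinorCone h, IsRepresentativeSpinor (rowSpace U) s := by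
  have hrep : IsRepresentativeSpinor (rowSpace U)
      (actList ((List.finRange h).map (rowVec U)) (1 : Spinor h)) := by
    refine ⟨isMaximalIsotropic_rowSpace hU, fun h0 => ?_,
      Module.Basis.span (linearIndependent_rowVec U), cliffordProd (fVec h), ?_⟩
    · have := actList_fVec_reverse (pol_fVec_rowVec U) act_fVec_one
        (List.nodup_reverse.2 (List.nodup_finRange h))
      rw [List.reverse_reverse, h0, actList_eq, map_zero] at this
      have h1 := congrArg (ExteriorAlgebra.algebraMapInv (R := ℂ) (M := E h)) this
      rw [map_zero, map_one] at h1
      exact zero_ne_one h1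
    · rw [toIdeal_actList, toIdeal_one, map_finRange, ← cliffordProd_eq]
      congr 2
      funext i
      exact (congrArg Subtype.val
        (Module.Basis.span_apply (linearIndependent_rowVec U) i)).symm
  refine ⟨_, Or.inr ⟨?_, _, hrep⟩, hrep⟩
  simpa using actList_one_mem_evenOdd ((List.finRange h).map (rowVec U))

/-! ### Differentials of polynomial functions -/

section Polynomial

variable {M : Type*} [AddCommGroup M] [Module ℂ M]

theorem polyDiff_eq_sum {p : MvPolynomial (Module.Dual ℂ M) ℂ} {T : Finset (Module.Dual ℂ M)}
    (hT : p.vars ⊆ T) (x : M) :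
    polyDiff p x = ∑ ℓ ∈ T, polyEval (MvPolynomial.pderiv ℓ p) x • ℓ := by
  refine Finset.sum_subset hT fun ℓ _ hℓ => ?_
  rw [MvPolynomial.pderiv_eq_zero_of_notMem_vars hℓ]
  simp [polyEval]

theorem polyDiff_add (p q : MvPolynomial (Module.Dual ℂ M) ℂ) (x : M) :
    polyDiff (p + q) x = polyDiff p x + polyDiff q x := by
  classical
  rw [polyDiff_eq_sum (MvPolynomial.vars_add_subset p q),
    polyDiff_eq_sum (p := p) Finset.subset_union_left,
    polyDiff_eq_sum (p := q) Finset.subset_union_right, ← Finset.sum_add_distrib]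
  simp [polyEval, add_smul]

theorem polyDiff_sum {κ : Type*} (T : Finset κ) (p : κ → MvPolynomial (Module.Dual ℂ M) ℂ) (x : M) :
    polyDiff (∑ k ∈ T, p k) x = ∑ k ∈ T, polyDiff (p k) x := by
  classical
  induction T using Finset.induction_on with
  | empty => simp [polyDiff]
  | insert a T ha ih => rw [Finset.sum_insert ha, Finset.sum_insert ha, polyDiff_add, ih]

theorem polyDiff_X (ℓ : Module.Dual ℂ M) (x : M) : polyDiff (MvPolynomial.X ℓ) x = ℓ := by
  simp [polyDiff, polyEval]

theorem polyDiff_mul (p q : MvPolynomial (Module.Dual ℂ M) ℂ) (x : M) :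
    polyDiff (p * q) x = polyEval p x • polyDiff q x + polyEval q x • polyDiff p x := by
  classical
  rw [polyDiff_eq_sum (MvPolynomial.vars_mul p q),
    polyDiff_eq_sum (p := p) Finset.subset_union_left,
    polyDiff_eq_sum (p := q) Finset.subset_union_right, Finset.smul_sum, Finset.smul_sum,
    ← Finset.sum_add_distrib]
  refine Finset.sum_congr rfl fun ℓ _ => ?_
  simp only [polyEval, Derivation.leibniz, smul_eq_mul, map_add, map_mul, add_smul, mul_smul]

end Polynomial

/-! ### Cartan's quadrics and the tangent spaces -/

/-- The vector of `V` that represents a linear form by means of the polar form. -/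
def polDual (ℓ : Module.Dual ℂ (V h)) : V h :=
  Sum.elim (fun i => ℓ (fVec h i)) (fun i => ℓ (eVec h i))

theorem pol_polDual (ℓ : Module.Dual ℂ (V h)) (v : V h) : pol (polDual ℓ) v = ℓ v := by
  have hv : v = ∑ i, v (Sum.inl i) • eVec h i + ∑ i, v (Sum.inr i) • fVec h i := by
    funext k
    rcases k with k | k <;> simp [eVec, fVec, Pi.single_apply]
  conv_rhs => rw [hv]
  simp only [map_add, map_sum, map_smul, smul_eq_mul, ← Finset.sum_add_distrib, pol, polDual,
    Sum.elim_inl, Sum.elim_inr]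
  exact Finset.sum_congr rfl fun i _ => by ring

theorem nondegenerate_polarBilin : (QuadraticMap.polarBilin (Q h)).Nondegenerate := by
  have key : ∀ v : V h, (∀ w, pol v w = 0) → v = 0 := by
    intro v hv
    funext k
    rcases k with k | k
    · simpa [pol_comm v, pol_fVec] using hv (fVec h k)
    · simpa [pol_comm v, pol_eVec] using hv (eVec h k)
  refine ⟨fun v hv => key v fun w => ?_, fun v hv => key v fun w => ?_⟩
  · simpa [polar_Q] using hv w
  · simpa [polar_Q, pol_comm v] using hv w

/-- A maximal totally isotropic subspace is its own orthogonal. -/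
theorem IsMaximalIsotropic.mem_of_pol {W : Submodule ℂ (V h)} (hW : IsMaximalIsotropic W) {a : V h}
    (ha : ∀ w ∈ W, pol a w = 0) : a ∈ W := by
  have hle : W ≤ LinearMap.BilinForm.orthogonal (QuadraticMap.polarBilin (Q h)) W := by
    intro w hw u hu
    exact (polar_Q u w).trans (pol_eq_zero hW.1 hu hw)
  have heq := Submodule.eq_of_le_of_finrank_eq hle (by
    rw [LinearMap.BilinForm.finrank_orthogonal nondegenerate_polarBilin, hW.2]
    simp)
  rw [heq]
  intro w hw
  exact (polar_Q w a).trans ((pol_comm w a).trans (ha w hw))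

/-- Cartan's quadratic relations: if `s` represents `W`, then the linear forms `v ↦ α (v s)` and
`v ↦ β (v s)` vanish on `W`, hence are represented by vectors of `W`, which are orthogonal. -/
theorem IsRepresentativeSpinor.cartan {W : Submodule ℂ (V h)} {s : Spinor h}
    (hs : IsRepresentativeSpinor W s) (α β : Module.Dual ℂ (Spinor h)) :
    ∑ i, (α (act (eVec h i) s) * β (act (fVec h i) s) +
      α (act (fVec h i) s) * β (act (eVec h i) s)) = 0 := by
  have hmem : ∀ γ : Module.Dual ℂ (Spinor h), polDual (γ ∘ₗ act.flip s) ∈ W := fun γ =>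
    hs.1.mem_of_pol fun w hw => by
      rw [pol_polDual]
      simp [hs.act_eq_zero hw]
  have := pol_eq_zero hs.1.1 (hmem α) (hmem β)
  rw [pol] at this
  rw [← this]
  refine Finset.sum_congr rfl fun i _ => ?_
  simp [polDual]
  ring

/-- The quadratic relations hold to first order along tangent vectors. -/
theorem cartan_of_mem_affineTangentSpace {s t : Spinor h}
    (ht : t ∈ affineTangentSpace (spinorCone h) s) (α β : Module.Dual ℂ (Spinor h)) :
    ∑ i, (α (act (eVec h i) s) * β (act (fVec h i) t) +
      α (act (eVec h i) t) * β (act (fVec h i) s) +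
      (α (act (fVec h i) s) * β (act (eVec h i) t) +
      α (act (fVec h i) t) * β (act (eVec h i) s))) = 0 := by
  have := ht (∑ i, (MvPolynomial.X (α ∘ₗ act (eVec h i)) * MvPolynomial.X (β ∘ₗ act (fVec h i)) +
    MvPolynomial.X (α ∘ₗ act (fVec h i)) * MvPolynomial.X (β ∘ₗ act (eVec h i)))) (by
      rintro y (rfl | ⟨-, W, hW⟩)
      · simp [polyEval]
      · simpa [polyEval] using hW.cartan α β)
  rw [← this, polyDiff_sum, LinearMap.sum_apply]
  refine Finset.sum_congr rfl fun i _ => ?_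
  simp only [polyDiff_add, polyDiff_mul, polyDiff_X, LinearMap.add_apply, LinearMap.smul_apply,
    smul_eq_mul, polyEval, MvPolynomial.eval_X, LinearMap.comp_apply]
  ring

theorem act_rowVec (U : Matrix (Fin h) (Fin h) ℂ) (i : Fin h) (x : Spinor h) :
    act (rowVec U i) x = act (eVec h i) x + ∑ j, U i j • act (fVec h j) x := by
  rw [rowVec_eq]; simp

/-- Because `U` is skew symmetric, the Casimir tensor `∑ e_i ⊗ f_i + f_i ⊗ e_i` does not change
when the `e_i` are replaced by the rows of `[I | U]`. -/
theorem cartan_rowVec {U : Matrix (Fin h) (Fin h) ℂ} (hU : ∀ i j, U j i = -U i j) (x y : Spinor h)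
    (α β : Module.Dual ℂ (Spinor h)) :
    ∑ i, (α (act (rowVec U i) x) * β (act (fVec h i) y) +
      α (act (fVec h i) x) * β (act (rowVec U i) y)) =
    ∑ i, (α (act (eVec h i) x) * β (act (fVec h i) y) +
      α (act (fVec h i) x) * β (act (eVec h i) y)) := by
  have hz : ∑ i, ∑ j, U i j * α (act (fVec h j) x) * β (act (fVec h i) y) +
      ∑ i, ∑ j, U i j * α (act (fVec h i) x) * β (act (fVec h j) y) = 0 := by
    rw [Finset.sum_comm, ← Finset.sum_add_distrib]
    refine Finset.sum_eq_zero fun i _ => ?_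
    rw [← Finset.sum_add_distrib]
    refine Finset.sum_eq_zero fun j _ => ?_
    rw [hU i j]; ring
  rw [← add_zero (∑ i, (α (act (eVec h i) x) * _ + _)), ← hz, ← Finset.sum_add_distrib,
    ← Finset.sum_add_distrib]
  refine Finset.sum_congr rfl fun i _ => ?_
  simp only [act_rowVec, map_add, map_sum, map_smul, smul_eq_mul, add_mul, mul_add, Finset.sum_mul,
    Finset.mul_sum]
  rw [Finset.sum_congr rfl fun j _ => (by ring :
    α (act (fVec h i) x) * (U i j * β (act (fVec h j) y)) =
      U i j * α (act (fVec h i) x) * β (act (fVec h j) y))]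
  ring

/-- Upper bound for the affine tangent space at the spinor `s` of the graph of `U`: it is contained
in `ℂ s + Λ² F s`. -/
theorem exists_eq_of_mem_affineTangentSpace {U : Matrix (Fin h) (Fin h) ℂ}
    (hU : ∀ i j, U j i = -U i j) {s t : Spinor h} (hs : ∀ i, act (rowVec U i) s = 0) (h0 : s ≠ 0)
    (ht : t ∈ affineTangentSpace (spinorCone h) s) :
    ∃ (c : ℂ) (κ : Fin h → Fin h → ℂ), (∀ i j, κ j i = -κ i j) ∧
      t = c • s + ∑ i, ∑ j, κ i j • act (fVec h i) (act (fVec h j) s) := by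
  -- A linear form `γ` with `γ s = 1` yields the linear forms `γ ∘ w_j`, dual to the `f_i s`.
  obtain ⟨γ, hγ⟩ : ∃ γ : Module.Dual ℂ (Spinor h), γ s = 1 := by
    refine ⟨(topCoeff h s)⁻¹ • topCoeff h, ?_⟩
    simp [topCoeff_ne_zero hs h0]
  set m : Fin h → Fin h → ℂ := fun j i => γ (act (rowVec U j) (act (rowVec U i) t)) with hm
  have hskew : ∀ i j, m j i = -m i j := fun i j => by
    simp only [hm]
    rw [act_act, pol_rowVec_rowVec hU]; simp
  have hwf : ∀ i j, act (rowVec U j) (act (fVec h i) s) = if i = j then s else 0 := fun i j => by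
    rw [act_act, hs, pol_comm, pol_fVec_rowVec]
    split_ifs <;> simp
  have hwt : ∀ j, act (rowVec U j) t = -∑ i, m j i • act (fVec h i) s := by
    intro j
    rw [← sub_eq_zero, ← Module.forall_dual_apply_eq_zero_iff ℂ]
    intro α
    have h1 := cartan_of_mem_affineTangentSpace ht α (γ ∘ₗ act (rowVec U j))
    have h2 := cartan_rowVec hU s t α (γ ∘ₗ act (rowVec U j))
    have h3 := cartan_rowVec hU t s α (γ ∘ₗ act (rowVec U j))
    have h4 := congrArg₂ (· + ·) h2 h3
    simp only [← Finset.sum_add_distrib] at h4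
    replace h4 := h4.trans ((Finset.sum_congr rfl fun i _ => by ring).trans h1)
    simp only [hs, map_zero, zero_mul, mul_zero, zero_add, add_zero, LinearMap.comp_apply, hwf,
      Finset.sum_add_distrib] at h4
    simp only [apply_ite γ, hγ, map_zero, mul_ite, mul_one, mul_zero, Finset.sum_ite_eq',
      Finset.mem_univ, if_true] at h4
    simp only [sub_neg_eq_add, map_add, map_sum, map_smul, smul_eq_mul, hm]
    rw [← h4, add_comm]
    congr 1
    exact Finset.sum_congr rfl fun i _ => mul_comm _ _
  -- Subtracting the right element of `Λ² F s` from `t` leaves a spinor killed by all rows.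
  set t' : Spinor h := t - ∑ i, ∑ j, (m j i / 2) • act (fVec h i) (act (fVec h j) s) with ht'
  have hwff : ∀ i j k, act (rowVec U k) (act (fVec h i) (act (fVec h j) s)) =
      (if i = k then act (fVec h j) s else 0) - if j = k then act (fVec h i) s else 0 := by
    intro i j k
    rw [act_act, hwf, pol_comm, pol_fVec_rowVec]
    split_ifs <;> simp
  have hwt' : ∀ k, act (rowVec U k) t' = 0 := by
    intro k
    rw [ht', map_sub, hwt]
    simp only [map_sum, map_smul, hwff, smul_sub, smul_ite, smul_zero, Finset.sum_sub_distrib]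
    rw [Finset.sum_comm]
    simp only [Finset.sum_ite_eq', Finset.mem_univ, if_true]
    rw [sub_eq_zero, ← Finset.sum_sub_distrib, ← Finset.sum_neg_distrib]
    refine Finset.sum_congr rfl fun i _ => ?_
    rw [hskew i k, ← sub_smul, ← neg_smul]
    congr 1; ring
  refine ⟨topCoeff h t' / topCoeff h s, fun i j => m j i / 2, fun i j => by
    simp only; rw [hskew i j]; ring, ?_⟩
  have hne := topCoeff_ne_zero hs h0
  have : t' - (topCoeff h t' / topCoeff h s) • s = 0 := by
    refine eq_zero_of_topCoeff (U := U) (fun i => ?_) ?_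
    · simp [hwt', hs]
    · simp [hne]
  rw [sub_eq_zero] at this
  rw [← this, ht']
  abel

/-! ### Coefficients of spinors and weights -/

/-- The linear form that applies a word in the `e_i` to a spinor and takes the coefficient of
`e_1 ⋯ e_h`; for a word without repetitions this is, up to sign, the coordinate of the product of
the `e_i` that are not in the word. -/
def wordCoeff (L : List (Fin h)) : Spinor h →ₗ[ℂ] ℂ :=
  topCoeff h ∘ₗ spinRep h (listProd (L.map (eVec h)))

theorem wordCoeff_apply (L : List (Fin h)) (x : Spinor h) :
    wordCoeff L x = topCoeff h (actList (L.map (eVec h)) x) := by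
  rw [actList_eq]; rfl

theorem wordCoeff_nil (x : Spinor h) : wordCoeff [] x = topCoeff h x := by
  simp [wordCoeff_apply]

theorem wordCoeff_concat (L : List (Fin h)) (i : Fin h) (x : Spinor h) :
    wordCoeff (L ++ [i]) x = wordCoeff L (act (eVec h i) x) := by
  simp [wordCoeff_apply, actList_append]

theorem act_eVec_fVec_self (i : Fin h) (x : Spinor h) :
    act (eVec h i) (act (fVec h i) x) = x - act (fVec h i) (act (eVec h i) x) := by
  rw [act_act, pol_eVec_fVec, if_pos rfl, one_smul]

theorem act_eVec_fVec_of_ne {i j : Fin h} (hij : i ≠ j) (x : Spinor h) :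
    act (eVec h i) (act (fVec h j) x) = -act (fVec h j) (act (eVec h i) x) := by
  rw [act_act, pol_eVec_fVec, if_neg hij, zero_smul, zero_sub]

theorem act_fVec_fVec (i j : Fin h) (x : Spinor h) :
    act (fVec h i) (act (fVec h j) x) = -act (fVec h j) (act (fVec h i) x) := by
  rw [act_act, pol_fVec_fVec, zero_smul, zero_sub]

theorem act_eVec_eVec (i j : Fin h) (x : Spinor h) :
    act (eVec h i) (act (eVec h j) x) = -act (eVec h j) (act (eVec h i) x) := by
  rw [act_act, pol_eVec_eVec, zero_smul, zero_sub]

theorem act_fVec_self (i : Fin h) (x : Spinor h) : act (fVec h i) (act (fVec h i) x) = 0 := by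
  rw [act_act_self, Q_fVec, zero_smul]

theorem wordCoeff_act_fVec {L : List (Fin h)} {i : Fin h} (hi : i ∉ L) (x : Spinor h) :
    wordCoeff L (act (fVec h i) x) = 0 := by
  induction L using List.reverseRecOn generalizing x with
  | nil => rw [wordCoeff_nil, topCoeff_act_fVec]
  | append_singleton L j ih =>
    simp only [List.mem_append, List.mem_singleton, not_or] at hi
    rw [wordCoeff_concat, act_eVec_fVec_of_ne (Ne.symm hi.2), map_neg, ih hi.1, neg_zero]

/-- The element `∑ θ_i f_i e_i` of the Lie algebra of the diagonal torus, acting on spinors. -/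
def torus (θ : Fin h → ℂ) (x : Spinor h) : Spinor h :=
  ∑ i, θ i • act (fVec h i) (act (eVec h i) x)

theorem torus_act_fVec (θ : Fin h → ℂ) (i : Fin h) (x : Spinor h) :
    torus θ (act (fVec h i) x) = act (fVec h i) (torus θ x) + θ i • act (fVec h i) x := by
  have : ∀ j, act (fVec h j) (act (eVec h j) (act (fVec h i) x)) =
      act (fVec h i) (act (fVec h j) (act (eVec h j) x)) +
        if j = i then act (fVec h j) x else 0 := by
    intro j
    rw [act_act (eVec h j), pol_eVec_fVec, map_sub, act_fVec_fVec i j]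
    split_ifs with hji <;> simp; abel
  simp [torus, this, smul_add, Finset.sum_add_distrib]

theorem act_eVec_torus (θ : Fin h → ℂ) (i : Fin h) (x : Spinor h) :
    act (eVec h i) (torus θ x) = torus θ (act (eVec h i) x) + θ i • act (eVec h i) x := by
  have : ∀ j, act (eVec h i) (act (fVec h j) (act (eVec h j) x)) =
      act (fVec h j) (act (eVec h j) (act (eVec h i) x)) +
        if j = i then act (eVec h j) x else 0 := by
    intro j
    rw [act_act (eVec h i) (fVec h j), pol_eVec_fVec, act_eVec_eVec i j, map_neg]
    by_cases hji : j = i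
    · subst hji; simp [add_comm]
    · simp [hji, Ne.symm hji]
  simp [torus, this, smul_add, Finset.sum_add_distrib]

/-- A coordinate is a weight vector of the torus. -/
theorem wordCoeff_torus (θ : Fin h → ℂ) (L : List (Fin h)) (x : Spinor h) :
    wordCoeff L (torus θ x) = (L.map θ).sum * wordCoeff L x := by
  induction L using List.reverseRecOn generalizing x with
  | nil => simp [wordCoeff_nil, torus, topCoeff_act_fVec]
  | append_singleton L j ih =>
    rw [wordCoeff_concat, act_eVec_torus, map_add, ih, map_smul, wordCoeff_concat]
    simp; ring

theorem act_eVec_of_killed {U : Matrix (Fin h) (Fin h) ℂ} {s : Spinor h}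
    (hs : ∀ i, act (rowVec U i) s = 0) (i : Fin h) :
    act (eVec h i) s = -∑ j, U i j • act (fVec h j) s := by
  rw [eq_neg_iff_add_eq_zero, ← act_rowVec, hs]

/-- The spinors of the graph of `U` are invariant under the part of the torus that fixes `U`. -/
theorem torus_eq_zero {U : Matrix (Fin h) (Fin h) ℂ} (hU : ∀ i j, U j i = -U i j) {s : Spinor h}
    (hs : ∀ i, act (rowVec U i) s = 0) {θ : Fin h → ℂ} (hθ : ∀ i j, U i j * (θ i + θ j) = 0) :
    torus θ s = 0 := by
  have h1 : torus θ s = -∑ i, ∑ j, (θ i * U i j) • act (fVec h i) (act (fVec h j) s) := by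
    simp [torus, act_eVec_of_killed hs, Finset.smul_sum, smul_smul]
  have h2 : torus θ s = -∑ i, ∑ j, (θ j * U i j) • act (fVec h i) (act (fVec h j) s) := by
    rw [h1, Finset.sum_comm]
    congr 1
    refine Finset.sum_congr rfl fun i _ => Finset.sum_congr rfl fun j _ => ?_
    rw [act_fVec_fVec, hU i j]; simp
  have h3 : torus θ s + torus θ s = 0 := by
    conv_lhs => rw [h1]
    conv_lhs => arg 2; rw [← h1, h2]
    rw [← neg_add, ← Finset.sum_add_distrib, neg_eq_zero]
    refine Finset.sum_eq_zero fun i _ => ?_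
    rw [← Finset.sum_add_distrib]
    refine Finset.sum_eq_zero fun j _ => ?_
    rw [← add_smul, show θ i * U i j + θ j * U i j = 0 by linear_combination hθ i j, zero_smul]
  rw [← two_smul ℂ] at h3
  exact (smul_eq_zero.1 h3).resolve_left two_ne_zero

/-- Coordinates of nonzero weight vanish on invariant spinors. -/
theorem wordCoeff_eq_zero_of_weight {U : Matrix (Fin h) (Fin h) ℂ} (hU : ∀ i j, U j i = -U i j)
    {s : Spinor h} (hs : ∀ i, act (rowVec U i) s = 0) {θ : Fin h → ℂ}
    (hθ : ∀ i j, U i j * (θ i + θ j) = 0) {L : List (Fin h)} (hL : (L.map θ).sum ≠ 0) :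
    wordCoeff L s = 0 := by
  have := wordCoeff_torus θ L s
  rw [torus_eq_zero hU hs hθ, map_zero] at this
  exact (mul_eq_zero.1 this.symm).resolve_left hL

/-- Since `f_i f_j s` has weight `θ_i + θ_j`, its coordinates of other weights vanish. -/
theorem wordCoeff_fVec_fVec_eq_zero_of_weight {U : Matrix (Fin h) (Fin h) ℂ}
    (hU : ∀ i j, U j i = -U i j)
    {s : Spinor h} (hs : ∀ i, act (rowVec U i) s = 0) {θ : Fin h → ℂ}
    (hθ : ∀ i j, U i j * (θ i + θ j) = 0) {L : List (Fin h)} {i j : Fin h}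
    (hL : (L.map θ).sum ≠ θ i + θ j) :
    wordCoeff L (act (fVec h i) (act (fVec h j) s)) = 0 := by
  have := wordCoeff_torus θ L (act (fVec h i) (act (fVec h j) s))
  rw [torus_act_fVec, torus_act_fVec, torus_eq_zero hU hs hθ] at this
  simp only [map_zero, zero_add, map_add, map_smul, smul_eq_mul] at this
  refine (mul_eq_zero.1 (?_ : ((L.map θ).sum - (θ i + θ j)) * _ = 0)).resolve_left
    (sub_ne_zero.2 hL)
  linear_combination -this

/-! ### Block matrices -/

/-- The first index of the `b`-th block. -/
def evenIx (hh : 12 ≤ h) (b : Fin 6) : Fin h := ⟨2 * b.val, by omega⟩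

/-- The second index of the `b`-th block. -/
def oddIx (hh : 12 ≤ h) (b : Fin 6) : Fin h := ⟨2 * b.val + 1, by omega⟩

theorem blockMatrix_skew (t : Fin 6 → ℂ) (i j : Fin h) :
    blockMatrix h t j i = -blockMatrix h t i j := by
  simp only [blockMatrix, Matrix.of_apply, ← Finset.sum_neg_distrib]
  refine Finset.sum_congr rfl fun b _ => ?_
  split_ifs <;> first | omega | simp

theorem blockMatrix_evenIx (hh : 12 ≤ h) (t : Fin 6 → ℂ) (b : Fin 6) (j : Fin h) :
    blockMatrix h t (evenIx hh b) j = if j = oddIx hh b then t b else 0 := by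
  simp only [blockMatrix, Matrix.of_apply, evenIx, oddIx, Fin.ext_iff]
  rw [Finset.sum_eq_single b]
  · split_ifs <;> first | omega | rfl
  · intro c _ hc
    have := Fin.val_ne_of_ne hc
    split_ifs <;> first | omega | rfl
  · simp

theorem blockMatrix_oddIx (hh : 12 ≤ h) (t : Fin 6 → ℂ) (b : Fin 6) (j : Fin h) :
    blockMatrix h t (oddIx hh b) j = if j = evenIx hh b then -t b else 0 := by
  rw [blockMatrix_skew]
  simp only [blockMatrix, Matrix.of_apply, evenIx, oddIx, Fin.ext_iff]
  rw [Finset.sum_eq_single b]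
  · split_ifs <;> first | omega | simp
  · intro c _ hc
    have := Fin.val_ne_of_ne hc
    split_ifs <;> first | omega | rfl
  · simp

/-- The weights of a torus that fixes every block matrix: for `c < 6`, the one with entries `1, -1`
on the `c`-th block; for `c ≥ 12`, the coordinate of index `c`. -/
def blockWeight (c i : ℕ) : ℤ :=
  if i < 12 then (if i / 2 = c then (if i % 2 = 0 then 1 else -1) else 0)
  else if i = c then 1 else 0

theorem blockMatrix_mul_weight (t : Fin 6 → ℂ) (c : ℕ) (i j : Fin h) :
    blockMatrix h t i j * ((blockWeight c i : ℂ) + blockWeight c j) = 0 := by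
  simp only [blockMatrix, Matrix.of_apply, Finset.sum_mul]
  refine Finset.sum_eq_zero fun b _ => ?_
  rw [← Int.cast_add]
  split_ifs with h1 h2
  · rw [show blockWeight c i + blockWeight c j = 0 by
      simp only [blockWeight]; split_ifs <;> omega]
    simp
  · rw [show blockWeight c i + blockWeight c j = 0 by
      simp only [blockWeight]; split_ifs <;> omega]
    simp
  · simp

/-- The index `c` for which the weight `blockWeight c` does not vanish at `p`. -/
def blockIx (p : ℕ) : ℕ := if p < 12 then p / 2 else p

theorem blockWeight_mem (c i : ℕ) :
    blockWeight c i = -1 ∨ blockWeight c i = 0 ∨ blockWeight c i = 1 := by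
  simp only [blockWeight]
  split_ifs <;> simp

theorem blockWeight_blockIx (p : ℕ) :
    blockWeight (blockIx p) p = -1 ∨ blockWeight (blockIx p) p = 1 := by
  simp only [blockWeight, blockIx]
  split_ifs <;> simp_all

theorem eq_of_blockWeight_blockIx {p i : ℕ}
    (hi : blockWeight (blockIx p) i = blockWeight (blockIx p) p) : i = p := by
  simp only [blockWeight, blockIx] at hi
  split_ifs at hi <;> omega

theorem blockWeight_blockIx_of_ne {p q : ℕ} (hpq : p ≠ q)
    (hn : ¬ (p < 12 ∧ q < 12 ∧ p / 2 = q / 2)) : blockWeight (blockIx p) q = 0 := by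
  simp only [blockWeight, blockIx]
  split_ifs <;> omega

/-- The weights determine a pair of indices that is not a block. -/
theorem eq_of_blockWeight {i j p q : ℕ} (hpq : p ≠ q) (hn : ¬ (p < 12 ∧ q < 12 ∧ p / 2 = q / 2))
    (H : ∀ c, blockWeight c p + blockWeight c q = blockWeight c i + blockWeight c j) :
    (i = p ∧ j = q) ∨ (i = q ∧ j = p) := by
  have key : ∀ {p q : ℕ}, p ≠ q → ¬ (p < 12 ∧ q < 12 ∧ p / 2 = q / 2) →
      (∀ c, blockWeight c p + blockWeight c q = blockWeight c i + blockWeight c j) →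
      i = p ∨ j = p := by
    intro p q hpq hn H
    have h1 := H (blockIx p)
    rw [blockWeight_blockIx_of_ne hpq hn] at h1
    rcases blockWeight_mem (blockIx p) i with hi | hi | hi <;>
    rcases blockWeight_mem (blockIx p) j with hj | hj | hj <;>
    rcases blockWeight_blockIx p with hp | hp <;>
    first
    | omega
    | exact Or.inl (eq_of_blockWeight_blockIx (by omega))
    | exact Or.inr (eq_of_blockWeight_blockIx (by omega))
  have h1 := key hpq hn H
  have h2 := key hpq.symm (by omega) (fun c => by rw [add_comm, H])
  omega

theorem exists_blockWeight_ne {p q : ℕ} (hpq : p ≠ q)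
    (hn : ¬ (p < 12 ∧ q < 12 ∧ p / 2 = q / 2)) :
    ∃ c, blockWeight c p + blockWeight c q ≠ 0 := by
  refine ⟨blockIx p, ?_⟩
  have := blockWeight_blockIx p
  rw [blockWeight_blockIx_of_ne hpq hn]
  omega

/-- Two indices of opposite weights form a block. -/
theorem partner_of_blockWeight {i j : ℕ} (H : ∀ c, 0 = blockWeight c i + blockWeight c j) :
    i < 12 ∧ j < 12 ∧ i / 2 = j / 2 ∧ i ≠ j := by
  have h1 := H (if i < 12 then i / 2 else i)
  simp only [blockWeight] at h1
  split_ifs at h1 <;> omega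

section Blocks

variable (hh : 12 ≤ h) {t : Fin 6 → ℂ} {s : Spinor h}

theorem evenIx_ne_oddIx (b c : Fin 6) : evenIx hh b ≠ oddIx hh c := by
  simp only [evenIx, oddIx, ne_eq, Fin.ext_iff]; omega

theorem evenIx_injective : Function.Injective (evenIx hh) := fun b c hbc => by
  simp only [evenIx, Fin.ext_iff] at hbc ⊢; omega

theorem oddIx_injective : Function.Injective (oddIx hh) := fun b c hbc => by
  simp only [oddIx, Fin.ext_iff] at hbc ⊢; omega

theorem act_evenIx (hs : ∀ i, act (rowVec (blockMatrix h t) i) s = 0)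
    (b : Fin 6) :
    act (eVec h (evenIx hh b)) s = -(t b • act (fVec h (oddIx hh b)) s) := by
  rw [act_eVec_of_killed hs]
  simp [blockMatrix_evenIx]

theorem act_oddIx (hs : ∀ i, act (rowVec (blockMatrix h t) i) s = 0)
    (b : Fin 6) :
    act (eVec h (oddIx hh b)) s = t b • act (fVec h (evenIx hh b)) s := by
  rw [act_eVec_of_killed hs]
  simp [blockMatrix_oddIx]

theorem act_block (hs : ∀ i, act (rowVec (blockMatrix h t) i) s = 0)
    (b : Fin 6) : act (eVec h (oddIx hh b)) (act (eVec h (evenIx hh b)) s) =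
    act (fVec h (oddIx hh b)) ((t b * t b) • act (fVec h (evenIx hh b)) s) - t b • s := by
  rw [act_evenIx hh hs, map_neg, map_smul, act_eVec_fVec_self, act_oddIx hh hs]
  simp only [map_smul, smul_sub, smul_smul]
  abel

theorem wordCoeff_block (hs : ∀ i, act (rowVec (blockMatrix h t) i) s = 0)
    {L : List (Fin h)} {b : Fin 6} (hb : oddIx hh b ∉ L) :
    wordCoeff (L ++ [oddIx hh b, evenIx hh b]) s = -t b * wordCoeff L s := by
  rw [List.append_cons, wordCoeff_concat, wordCoeff_concat, act_block hh hs, map_sub,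
    wordCoeff_act_fVec hb]
  simp

theorem wordCoeff_block_self (hs : ∀ i, act (rowVec (blockMatrix h t) i) s = 0)
    {L : List (Fin h)} {b : Fin 6} (hb : oddIx hh b ∉ L) :
    wordCoeff (L ++ [oddIx hh b, evenIx hh b])
      (act (fVec h (evenIx hh b)) (act (fVec h (oddIx hh b)) s)) = wordCoeff L s := by
  rw [List.append_cons, wordCoeff_concat, wordCoeff_concat, act_eVec_fVec_self,
    act_eVec_fVec_of_ne (evenIx_ne_oddIx hh b b), act_evenIx hh hs]
  simp only [map_neg, map_smul, neg_neg, act_fVec_self, smul_zero, map_zero, sub_zero]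
  rw [act_eVec_fVec_self, map_sub, wordCoeff_act_fVec hb, sub_zero]

theorem wordCoeff_block_of_ne (hs : ∀ i, act (rowVec (blockMatrix h t) i) s = 0)
    {L : List (Fin h)} {b : Fin 6} (hb : oddIx hh b ∉ L) {i j : Fin h}
    (hi : i ≠ evenIx hh b) (hi' : i ≠ oddIx hh b) (hj : j ≠ evenIx hh b) (hj' : j ≠ oddIx hh b) :
    wordCoeff (L ++ [oddIx hh b, evenIx hh b]) (act (fVec h i) (act (fVec h j) s)) =
      -t b * wordCoeff L (act (fVec h i) (act (fVec h j) s)) := by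
  rw [List.append_cons, wordCoeff_concat, wordCoeff_concat, act_eVec_fVec_of_ne hi.symm,
    act_eVec_fVec_of_ne hj.symm]
  simp only [map_neg, neg_neg]
  rw [act_eVec_fVec_of_ne hi'.symm, act_eVec_fVec_of_ne hj'.symm]
  simp only [map_neg, neg_neg]
  rw [act_block hh hs, map_sub, map_sub, map_sub, act_fVec_fVec j, map_neg, act_fVec_fVec i,
    neg_neg, wordCoeff_act_fVec hb]
  simp

/-- The coordinate of index `L` separates a pair of indices `p, q` that is not a block: on the
tangent space, it is a multiple of the coefficient of `f_p f_q s` when `L` consists of `p, q` and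
of a block that contains neither of them. -/
theorem wordCoeff_pair (hs : ∀ i, act (rowVec (blockMatrix h t) i) s = 0)
    {p q : Fin h} (hpq : p ≠ q)
    (hn : ¬ (p.val < 12 ∧ q.val < 12 ∧ p.val / 2 = q.val / 2)) {b : Fin 6}
    (hp : p.val / 2 ≠ b.val) (hq : q.val / 2 ≠ b.val) (c : ℂ) {κ : Fin h → Fin h → ℂ}
    (hκ : ∀ i j, κ j i = -κ i j) :
    wordCoeff ([q, p] ++ [oddIx hh b, evenIx hh b])
      (c • s + ∑ i, ∑ j, κ i j • act (fVec h i) (act (fVec h j) s)) =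
        -t b * (2 * κ p q * topCoeff h s) := by
  have hpq' : p.val ≠ q.val := Fin.val_ne_of_ne hpq
  have hsum : ∀ c : ℕ, ((([q, p] ++ [oddIx hh b, evenIx hh b]).map
      fun i : Fin h => (blockWeight c i : ℂ)).sum) = blockWeight c p + blockWeight c q := by
    intro c
    have : blockWeight c (oddIx hh b) + blockWeight c (evenIx hh b) = 0 := by
      simp only [blockWeight, oddIx, evenIx]; split_ifs <;> omega
    have := congrArg (Int.cast (R := ℂ)) this
    push_cast at this
    simp
    linear_combination this
  have hodd : oddIx hh b ∉ [q, p] := by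
    simp only [List.mem_cons, List.not_mem_nil, or_false, not_or, oddIx, Fin.ext_iff]
    omega
  have hs0 : wordCoeff ([q, p] ++ [oddIx hh b, evenIx hh b]) s = 0 := by
    obtain ⟨c, hc⟩ := exists_blockWeight_ne hpq' hn
    refine wordCoeff_eq_zero_of_weight (blockMatrix_skew t) hs (blockMatrix_mul_weight t c) ?_
    rw [hsum]
    exact_mod_cast hc
  have hz : ∀ i j : Fin h, ¬ ((i = p ∧ j = q) ∨ (i = q ∧ j = p)) →
      wordCoeff ([q, p] ++ [oddIx hh b, evenIx hh b]) (act (fVec h i) (act (fVec h j) s)) = 0 := by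
    intro i j hij
    by_contra hne
    apply hij
    simp only [Fin.ext_iff]
    refine eq_of_blockWeight hpq' hn fun c => ?_
    by_contra hc
    refine hne (wordCoeff_fVec_fVec_eq_zero_of_weight (blockMatrix_skew t) hs
      (blockMatrix_mul_weight t c) ?_)
    rw [hsum]
    exact_mod_cast hc
  have hval : wordCoeff ([q, p] ++ [oddIx hh b, evenIx hh b])
      (act (fVec h p) (act (fVec h q) s)) = -t b * topCoeff h s := by
    rw [wordCoeff_block_of_ne hh hs hodd (by simp only [ne_eq, evenIx, Fin.ext_iff]; omega)
      (by simp only [ne_eq, oddIx, Fin.ext_iff]; omega)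
      (by simp only [ne_eq, evenIx, Fin.ext_iff]; omega)
      (by simp only [ne_eq, oddIx, Fin.ext_iff]; omega),
      show [q, p] = [q] ++ [p] from rfl, wordCoeff_concat, act_eVec_fVec_self, map_sub,
      wordCoeff_act_fVec (L := [q]) (i := p) (by simpa using hpq), sub_zero,
      show [q] = [] ++ [q] from rfl,
      wordCoeff_concat, act_eVec_fVec_self, map_sub, wordCoeff_act_fVec (by simp), sub_zero,
      wordCoeff_nil]
  rw [map_add, map_smul, hs0, smul_zero, zero_add, map_sum,
    Finset.sum_eq_add p q hpq]
  · rw [map_sum, map_sum, Finset.sum_eq_single q, Finset.sum_eq_single p, act_fVec_fVec q p,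
      hκ p q]
    · simp only [map_smul, map_neg, hval, smul_eq_mul]; ring
    · intro j _ hj
      rw [map_smul, hz _ _ (by simp [hj, hpq.symm]), smul_zero]
    · simp
    · intro j _ hj
      rw [map_smul, hz _ _ (by simp [hj, hpq]), smul_zero]
    · simp
  · rintro i _ ⟨hip, hiq⟩
    rw [map_sum]
    refine Finset.sum_eq_zero fun j _ => ?_
    rw [map_smul, hz _ _ (by simp [hip, hiq]), smul_zero]
  · simp
  · simp

end Blocks

/-! ### Coordinates indexed by sets of blocks -/

section BlockWords

variable (hh : 12 ≤ h)

/-- The word formed by the indices of the blocks of a list. -/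
def blockWord : List (Fin 6) → List (Fin h)
  | [] => []
  | b :: l => blockWord l ++ [oddIx hh b, evenIx hh b]

theorem oddIx_mem_blockWord {b : Fin 6} {l : List (Fin 6)} :
    oddIx hh b ∈ blockWord hh l ↔ b ∈ l := by
  induction l with
  | nil => simp [blockWord]
  | cons c l ih =>
    simp [blockWord, ih, (evenIx_ne_oddIx hh c b).symm, (oddIx_injective hh).eq_iff, or_comm]

theorem evenIx_mem_blockWord {b : Fin 6} {l : List (Fin 6)} :
    evenIx hh b ∈ blockWord hh l ↔ b ∈ l := by
  induction l with
  | nil => simp [blockWord]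
  | cons c l ih =>
    simp [blockWord, ih, evenIx_ne_oddIx hh b c, (evenIx_injective hh).eq_iff, or_comm]

theorem sum_blockWeight_blockWord (c : ℕ) (l : List (Fin 6)) :
    ((blockWord hh l).map fun i : Fin h => (blockWeight c i : ℂ)).sum = 0 := by
  induction l with
  | nil => simp [blockWord]
  | cons b l ih =>
    have : blockWeight c (oddIx hh b) + blockWeight c (evenIx hh b) = 0 := by
      simp only [blockWeight, oddIx, evenIx]; split_ifs <;> omega
    have := congrArg (Int.cast (R := ℂ)) this
    push_cast at this
    rw [blockWord, List.map_append, List.sum_append, ih]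
    simpa using this

/-- The product of the entries `-t_b` over a list of blocks. -/
def blockProd (t : Fin 6 → ℂ) (l : List (Fin 6)) : ℂ := (l.map fun b => -t b).prod

variable {t : Fin 6 → ℂ} {s : Spinor h}

theorem wordCoeff_blockWord (hs : ∀ i, act (rowVec (blockMatrix h t) i) s = 0) {l : List (Fin 6)}
    (hl : l.Nodup) : wordCoeff (blockWord hh l) s = blockProd t l * topCoeff h s := by
  induction l with
  | nil => simp [blockWord, blockProd, wordCoeff_nil]
  | cons b l ih =>
    obtain ⟨hb, hl⟩ := List.nodup_cons.1 hl
    rw [blockWord, wordCoeff_block hh hs (by rwa [oddIx_mem_blockWord]), ih hl]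
    simp [blockProd, mul_assoc]

theorem wordCoeff_blockWord_pair (hs : ∀ i, act (rowVec (blockMatrix h t) i) s = 0)
    {l : List (Fin 6)} (hl : l.Nodup) (b : Fin 6) :
    wordCoeff (blockWord hh l) (act (fVec h (evenIx hh b)) (act (fVec h (oddIx hh b)) s)) =
      (if b ∈ l then blockProd t (l.erase b) else 0) * topCoeff h s := by
  split_ifs with hbl
  · induction l with
    | nil => simp at hbl
    | cons c l ih =>
      obtain ⟨hc, hl⟩ := List.nodup_cons.1 hl
      rw [blockWord]
      by_cases hbc : c = b
      · subst hbc
        rw [wordCoeff_block_self hh hs (by rwa [oddIx_mem_blockWord]),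
          wordCoeff_blockWord hh hs hl, List.erase_cons_head]
      · have hbl' : b ∈ l := (List.mem_cons.1 hbl).resolve_left (Ne.symm hbc)
        rw [wordCoeff_block_of_ne hh hs (by rwa [oddIx_mem_blockWord])
          ((evenIx_injective hh).ne (Ne.symm hbc)) (evenIx_ne_oddIx hh b c)
          (evenIx_ne_oddIx hh c b).symm ((oddIx_injective hh).ne (Ne.symm hbc)), ih hl hbl',
          List.erase_cons_tail (by simpa using hbc)]
        simp [blockProd]; ring
  · rw [wordCoeff_act_fVec (by rwa [evenIx_mem_blockWord]), zero_mul]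

/-- A sum over all indices of a function supported on the blocks. -/
theorem sum_eq_sum_blocks {G : Fin h → ℂ} (hG : ∀ i : Fin h, 12 ≤ i.val → G i = 0) :
    ∑ i, G i = ∑ b : Fin 6, (G (evenIx hh b) + G (oddIx hh b)) := by
  rw [Finset.sum_add_distrib]
  refine Eq.trans ?_ (Fintype.sum_sum_type
    (Sum.elim (fun b : Fin 6 => G (evenIx hh b)) fun b : Fin 6 => G (oddIx hh b)))
  refine (Fintype.sum_of_injective (Sum.elim (evenIx hh) (oddIx hh)) ?_ _ _ ?_ ?_).symm
  · exact (evenIx_injective hh).sumElim (oddIx_injective hh) (evenIx_ne_oddIx hh)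
  · intro i hi
    refine hG i ?_
    by_contra hlt
    apply hi
    rcases Nat.mod_two_eq_zero_or_one i.val with h2 | h2
    · exact ⟨Sum.inl ⟨i.val / 2, by omega⟩, by simp only [Sum.elim_inl, evenIx, Fin.ext_iff]; omega⟩
    · exact ⟨Sum.inr ⟨i.val / 2, by omega⟩, by simp only [Sum.elim_inr, oddIx, Fin.ext_iff]; omega⟩
  · rintro (b | b) <;> rfl

/-- The coordinate of index a set of blocks, on the tangent space. -/
theorem wordCoeff_blockWord_tangent (hs : ∀ i, act (rowVec (blockMatrix h t) i) s = 0)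
    {l : List (Fin 6)} (hl : l.Nodup) (c : ℂ) {κ : Fin h → Fin h → ℂ}
    (hκ : ∀ i j, κ j i = -κ i j) :
    wordCoeff (blockWord hh l) (c • s + ∑ i, ∑ j, κ i j • act (fVec h i) (act (fVec h j) s)) =
      (c * topCoeff h s) * blockProd t l + ∑ b : Fin 6,
        (2 * κ (evenIx hh b) (oddIx hh b) * topCoeff h s) *
          if b ∈ l then blockProd t (l.erase b) else 0 := by
  set g : Fin h → Fin h → ℂ := fun i j =>
    wordCoeff (blockWord hh l) (act (fVec h i) (act (fVec h j) s)) with hg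
  have hz : ∀ i j : Fin h, ¬ (i.val < 12 ∧ j.val < 12 ∧ i.val / 2 = j.val / 2 ∧ i.val ≠ j.val) →
      g i j = 0 := by
    intro i j hij
    by_contra hne
    refine hij (partner_of_blockWeight fun c => ?_)
    by_contra hc
    refine hne (wordCoeff_fVec_fVec_eq_zero_of_weight (blockMatrix_skew t) hs
      (blockMatrix_mul_weight t c) ?_)
    rw [sum_blockWeight_blockWord]
    exact_mod_cast hc
  have hgs : ∀ b : Fin 6, g (oddIx hh b) (evenIx hh b) = -g (evenIx hh b) (oddIx hh b) :=
    fun b => by simp only [hg]; rw [act_fVec_fVec, map_neg]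
  rw [map_add, map_smul, wordCoeff_blockWord hh hs hl, map_sum]
  simp only [map_sum, map_smul, smul_eq_mul]
  rw [sum_eq_sum_blocks hh (G := fun i => ∑ j, κ i j * g i j)]
  · congr 1
    · ring
    · refine Finset.sum_congr rfl fun b _ => ?_
      rw [Finset.sum_eq_single (oddIx hh b), Finset.sum_eq_single (evenIx hh b), hgs,
        hκ (evenIx hh b)]
      · simp only [hg]
        rw [wordCoeff_blockWord_pair hh hs hl]
        ring
      · intro j _ hj
        rw [hz, mul_zero]
        simp only [ne_eq, oddIx, evenIx, Fin.ext_iff] at hj ⊢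
        omega
      · simp
      · intro j _ hj
        rw [hz, mul_zero]
        simp only [ne_eq, oddIx, evenIx, Fin.ext_iff] at hj ⊢
        omega
      · simp
  · intro i hi
    exact Finset.sum_eq_zero fun j _ => by rw [hz _ _ (by omega), mul_zero]

end BlockWords

/-! ### Independence -/

/-- The entries of the blocks of the `k`-th point. -/
def pointEntry : Fin 3 → Fin 6 → ℂ :=
  ![fun _ => 0, fun _ => 1, fun b => (b.val : ℂ) + 2]

theorem pointMatrix_eq (k : Fin 3) : pointMatrix h k = blockMatrix h (pointEntry k) := by
  fin_cases k
  · ext i j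
    simp [pointMatrix, pointEntry, blockMatrix]
  · rfl
  · rfl

/-- The linear relations between the coefficients of tangent vectors at the three points that come
from the coordinates indexed by sets of blocks. Sets of at least two blocks do not involve the first
point, whose entries are zero. -/
theorem coeff_eq_zero {A : Fin 3 → ℂ} {B : Fin 3 → Fin 6 → ℂ}
    (H : ∀ l : List (Fin 6), l.Nodup → ∑ k, (A k * blockProd (pointEntry k) l +
      ∑ b, B k b * if b ∈ l then blockProd (pointEntry k) (l.erase b) else 0) = 0) :
    (A 1 = 0 ∧ A 2 = 0) ∧ (∀ b, B 1 b = 0) ∧ ∀ b, B 2 b = 0 := by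
  -- These fourteen sets of two or three blocks already give an invertible system.
  have h01 := H [0, 1] (by decide)
  have h02 := H [0, 2] (by decide)
  have h03 := H [0, 3] (by decide)
  have h04 := H [0, 4] (by decide)
  have h05 := H [0, 5] (by decide)
  have h12 := H [1, 2] (by decide)
  have h13 := H [1, 3] (by decide)
  have h14 := H [1, 4] (by decide)
  have h15 := H [1, 5] (by decide)
  have h23 := H [2, 3] (by decide)
  have h24 := H [2, 4] (by decide)
  have h012 := H [0, 1, 2] (by decide)
  have h013 := H [0, 1, 3] (by decide)
  have h023 := H [0, 2, 3] (by decide)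
  clear H
  simp [Fin.sum_univ_succ, pointEntry, blockProd] at *
  have hA : A 2 = 0 ∧ A 1 = 0 := by constructor <;> grind
  obtain ⟨hA2, hA1⟩ := hA
  have h2 : B 2 0 = 0 ∧ B 2 1 = 0 ∧ B 2 2 = 0 ∧ B 2 3 = 0 ∧ B 2 4 = 0 ∧ B 2 5 = 0 := by
    refine ⟨?_, ?_, ?_, ?_, ?_, ?_⟩ <;> grind
  have h1 : B 1 0 = 0 ∧ B 1 1 = 0 ∧ B 1 2 = 0 ∧ B 1 3 = 0 ∧ B 1 4 = 0 ∧ B 1 5 = 0 := by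
    refine ⟨?_, ?_, ?_, ?_, ?_, ?_⟩ <;> grind
  refine ⟨⟨hA1, hA2⟩, fun b => ?_, fun b => ?_⟩
  · fin_cases b <;> simp [h1]
  · fin_cases b <;> simp [h2]

/-- Two blocks that avoid two given indices. -/
theorem exists_two_blocks (m n : ℕ) : ∃ b b' : Fin 6, b ≠ b' ∧ m ≠ b.val ∧ n ≠ b.val ∧
    m ≠ b'.val ∧ n ≠ b'.val := by
  have key : ∃ b b' : ℕ, b < 6 ∧ b' < 6 ∧ b ≠ b' ∧ m ≠ b ∧ n ≠ b ∧ m ≠ b' ∧ n ≠ b' := by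
    by_contra! H
    have h01 := H 0 1
    have h02 := H 0 2
    have h03 := H 0 3
    have h12 := H 1 2
    have h13 := H 1 3
    have h23 := H 2 3
    omega
  obtain ⟨b, b', hb, hb', hne, h⟩ := key
  exact ⟨⟨b, hb⟩, ⟨b', hb'⟩, by simpa using hne, h⟩

/-- Tangent vectors at the three points whose sum is zero are zero. -/
theorem eq_zero_of_sum_tangent (hh : 12 ≤ h) {s t : Fin 3 → Spinor h}
    (hs : ∀ k, IsRepresentativeSpinor (rowSpace (pointMatrix h k)) (s k))
    (ht : ∀ k, t k ∈ affineTangentSpace (spinorCone h) (s k)) (hsum : ∑ k, t k = 0) (k : Fin 3) :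
    t k = 0 := by
  have hkill : ∀ k i, act (rowVec (blockMatrix h (pointEntry k)) i) (s k) = 0 := fun k i => by
    rw [← pointMatrix_eq]
    exact (hs k).act_eq_zero (rowVec_mem _ _)
  have hne : ∀ k, topCoeff h (s k) ≠ 0 := fun k => topCoeff_ne_zero (hkill k) (hs k).2.1
  choose c κ hκ hteq using fun k =>
    exists_eq_of_mem_affineTangentSpace (blockMatrix_skew _) (hkill k) (hs k).2.1 (ht k)
  -- The coordinates that involve a pair of indices which is not a block.
  have hpair : ∀ p q : Fin h, p ≠ q → ¬ (p.val < 12 ∧ q.val < 12 ∧ p.val / 2 = q.val / 2) →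
      κ 1 p q = 0 ∧ κ 2 p q = 0 := by
    intro p q hpq hn
    have heq : ∀ b : Fin 6, p.val / 2 ≠ b.val → q.val / 2 ≠ b.val →
        κ 1 p q * topCoeff h (s 1) + ((b.val : ℂ) + 2) * (κ 2 p q * topCoeff h (s 2)) = 0 := by
      intro b hp hq
      have := congrArg (wordCoeff ([q, p] ++ [oddIx hh b, evenIx hh b])) hsum
      rw [map_sum, map_zero, Finset.sum_congr rfl fun k _ => by
        rw [hteq k, wordCoeff_pair hh (hkill k) hpq hn hp hq (c k) (hκ k)]] at this
      simp only [Fin.sum_univ_three, pointEntry, Matrix.cons_val] at this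
      linear_combination (-1 / 2 : ℂ) * this
    obtain ⟨b, b', hbb, hp, hq, hp', hq'⟩ := exists_two_blocks (p.val / 2) (q.val / 2)
    have h1 := heq b hp hq
    have h2 := heq b' hp' hq'
    have hbb' : (b.val : ℂ) - b'.val ≠ 0 :=
      sub_ne_zero.2 fun hc => hbb (Fin.ext (Nat.cast_injective hc))
    have h3 : κ 2 p q * topCoeff h (s 2) = 0 := by
      refine (mul_eq_zero.1 (?_ : ((b.val : ℂ) - b'.val) * _ = 0)).resolve_left hbb'
      linear_combination h1 - h2
    rw [h3, mul_zero, add_zero] at h1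
    exact ⟨(mul_eq_zero.1 h1).resolve_right (hne 1), (mul_eq_zero.1 h3).resolve_right (hne 2)⟩
  -- The coordinates indexed by sets of blocks.
  obtain ⟨⟨hc1, hc2⟩, hb1, hb2⟩ := coeff_eq_zero
    (A := fun k => c k * topCoeff h (s k))
    (B := fun k b => 2 * κ k (evenIx hh b) (oddIx hh b) * topCoeff h (s k)) (by
      intro l hl
      have := congrArg (wordCoeff (blockWord hh l)) hsum
      rw [map_sum, map_zero, Finset.sum_congr rfl fun k _ => by
        rw [hteq k, wordCoeff_blockWord_tangent hh (hkill k) hl (c k) (hκ k)]] at this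
      exact this)
  have hzero : ∀ k, c k * topCoeff h (s k) = 0 →
      (∀ b, 2 * κ k (evenIx hh b) (oddIx hh b) * topCoeff h (s k) = 0) →
      (∀ p q : Fin h, p ≠ q → ¬ (p.val < 12 ∧ q.val < 12 ∧ p.val / 2 = q.val / 2) → κ k p q = 0) →
      t k = 0 := by
    intro k hc hb hn
    have hb' : ∀ b, κ k (evenIx hh b) (oddIx hh b) = 0 := fun b => by
      simpa [hne k] using hb b
    have hκ0 : ∀ p q, κ k p q = 0 := by
      intro p q
      by_cases hpq : p = q
      · subst hpq
        exact self_eq_neg.1 (hκ k p p)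
      by_cases hblk : p.val < 12 ∧ q.val < 12 ∧ p.val / 2 = q.val / 2
      · have hpq' := Fin.val_ne_of_ne hpq
        obtain ⟨hp, hq, hd⟩ := hblk
        obtain ⟨b, hbp⟩ : ∃ b : Fin 6, b.val = p.val / 2 := ⟨⟨p.val / 2, by omega⟩, rfl⟩
        rcases Nat.mod_two_eq_zero_or_one p.val with h2 | h2
        · have e1 : p = evenIx hh b := by
            simp only [evenIx, Fin.ext_iff]; omega
          have e2 : q = oddIx hh b := by
            simp only [oddIx, Fin.ext_iff]; omega
          rw [e1, e2]; exact hb' _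
        · have e1 : p = oddIx hh b := by
            simp only [oddIx, Fin.ext_iff]; omega
          have e2 : q = evenIx hh b := by
            simp only [evenIx, Fin.ext_iff]; omega
          rw [hκ k q p, neg_eq_zero, e1, e2]; exact hb' _
      · exact hn p q hpq hblk
    rw [hteq k, (mul_eq_zero.1 hc).resolve_right (hne k)]
    simp [hκ0]
  have h1 : t 1 = 0 := hzero 1 hc1 hb1 fun p q hpq hn => (hpair p q hpq hn).1
  have h2 : t 2 = 0 := hzero 2 hc2 hb2 fun p q hpq hn => (hpair p q hpq hn).2
  have h0 : t 0 = 0 := by simpa [Fin.sum_univ_three, h1, h2] using hsum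
  fin_cases k <;> assumption

end SpinorVariety

end

theorem theorem6p1 (h : ℕ) (hh : 12 ≤ h) :
    (∀ k : Fin 3, ∃ s ∈ SpinorVariety.spinorCone h,
      SpinorVariety.IsRepresentativeSpinor
        (SpinorVariety.rowSpace (SpinorVariety.pointMatrix h k)) s) ∧
    ∀ s : Fin 3 → SpinorVariety.Spinor h,
      (∀ k : Fin 3, SpinorVariety.IsRepresentativeSpinor
        (SpinorVariety.rowSpace (SpinorVariety.pointMatrix h k)) (s k)) →
      iSupIndep fun k : Fin 3 =>
        SpinorVariety.affineTangentSpace (SpinorVariety.spinorCone h) (s k) := by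
  refine ⟨fun k => ?_, fun s hs => ?_⟩
  · rw [SpinorVariety.pointMatrix_eq]
    exact SpinorVariety.exists_mem_spinorCone (SpinorVariety.blockMatrix_skew _)
  · rw [iSupIndep_iff_finsetSum_eq_zero_imp_eq_zero]
    intro S v hv hsum i hi
    have := SpinorVariety.eq_zero_of_sum_tangent hh (t := fun k => if k ∈ S then v k else 0) hs
      (fun k => by
        split_ifs with hk
        · exact hv k hk
        · exact Submodule.zero_mem _)
      (by simpa [Finset.sum_ite_mem] using hsum) i
    simpa [hi] using this
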